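/- Let $n,r\in\mathbb N=\{1,2,\dots\}$ and $s,\alpha\in(0,\infty)$ be such that $\alpha r>s$. For $h\in\mathbb R^n$ put $\Delta_hf(x)=f(x+\tfrac h2)-f(x-\tfrac h2)$ and $\Delta_h^{i+1}=\Delta_h^i\Delta_h$. Let $\Lambda_s$ be the space of all continuous functions $f:\mathbb R^n\to\mathbb R$ with $$\|f\|_{\Lambda_s}:=\|f\|_{L^\infty}+\sup_{0<y\le1}\ \sup_{x\in\mathbb R^n}\ \sup_{|h|=y}\frac{|\Delta_h^{\lfloor s\rfloor+1}f(x)|}{y^s}<\infty .$$ For $t>0$ and bounded continuous $f:\mathbb R^n\to\mathbb R$ let $T_{\alpha,t}f=e^{-t(-\Delta)^{\alpha/2}}f$, that is, $$T_{\alpha,t}f(x)=\int_{\mathbb R^n}K_\alpha(x-z,t)f(z)\,dz,\qquad K_\alpha(x,t)=\int_{\mathbb R^n}e^{-t|2\pi\xi|^\alpha}e^{2\pi ix\cdot\xi}\,d\xi ,$$ and let $(-\Delta)^{\beta/2}$, $\beta>0$, be defined in the distributional sense by $\mathcal F((-\Delta)^{\beta/2}g)(\xi)=|2\pi\xi|^\beta\mathcal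 Fg(\xi)$; for bounded $g$ this means $\langle(-\Delta)^{\beta/2}g,\mathcal F\psi\rangle=\int_{\mathbb R^n} g\,\mathcal F(|2\pi\cdot|^\beta\psi)\,dx$ for all Schwartz functions $\psi$, where $\mathcal F\psi(x)=\int_{\mathbb R^n}\psi(\xi)e^{-2\pi ix\cdot\xi}\,d\xi$. Here $\|\cdot\|_\infty$ denotes the $L^\infty$ norm, which is $\infty$ for a distribution not represented by an $L^\infty$ function. Let $f:\mathbb R^n\to\mathbb R$ be bounded and continuous. Then $f\in\Lambda_s$ if and only if $$S(f):=\sup_{t\in(0,\infty)}t^{\,r-\frac s\alpha}\left\|(-\Delta)^{\frac{\alpha r}2}(T_{\alpha,t}f)\right\|_\infty<\infty ,$$ in which case $$c\,\bigl(\|f\|_{L^\infty}+S(f)\bigr)\le\|f\|_{\Lambda_s}\le C\,\bigl(\|f\|_{L^\infty}+S(f)\bigr),$$ where $c,C\in(0,\infty)$ depend only on $n,s,\alpha,r$. -/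

import Mathlib

open MeasureTheory Set
open scoped ENNReal NNReal FourierTransform SchwartzMap

noncomputable section

namespace FracHeat

/-- The Euclidean space `ℝⁿ`. -/
abbrev E (n : ℕ) : Type := EuclideanSpace ℝ (Fin n)

/-- The first order symmetric difference `Δ_h f (x) = f (x + h/2) - f (x - h/2)`. -/
def diff {n : ℕ} (h : E n) (f : E n → ℝ) : E n → ℝ :=
  fun x => f (x + (2⁻¹ : ℝ) • h) - f (x - (2⁻¹ : ℝ) • h)

/-- The `k`-th order symmetric difference `Δ_h^k f`, with `Δ_h^{i+1} = Δ_h^i ∘ Δ_h`. -/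
def iterDiff {n : ℕ} (k : ℕ) (h : E n) (f : E n → ℝ) : E n → ℝ :=
  (diff h)^[k] f

/-- The modulus `Δ_k f (x, y) = sup_{|h| = y} |Δ_h^k f (x)|`, with values in `[0, ∞]`. -/
def modulus {n : ℕ} (k : ℕ) (f : E n → ℝ) (x : E n) (y : ℝ) : ℝ≥0∞ :=
  ⨆ (h : E n) (_ : ‖h‖ = y), ENNReal.ofReal |iterDiff k h f x|

/-- The inhomogeneous Lipschitz norm of order `s`, with values in `[0, ∞]`:
`‖f‖_{L^∞} + sup_{0 < y ≤ 1} sup_x Δ_k f (x, y) / y ^ s`, where `k = ⌊s⌋ + 1`. -/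
def lipNorm {n : ℕ} (s : ℝ) (f : E n → ℝ) : ℝ≥0∞ :=
  eLpNorm f ∞ volume +
    ⨆ (y : ℝ) (_ : y ∈ Ioc (0 : ℝ) 1) (x : E n),
      modulus (⌊s⌋₊ + 1) f x y / ENNReal.ofReal (y ^ s)

/-- The Lipschitz space `Λ_s`: continuous real functions of finite Lipschitz norm. -/
def LipSpace (n : ℕ) (s : ℝ) : Set (E n → ℝ) :=
  {f | Continuous f ∧ lipNorm s f < ∞}

/-- The kernel `K_α(x, t) = ∫ e^{- t |2πξ|^α} e^{2πi x·ξ} dξ` of `e^{-t(-Δ)^{α/2}}`. -/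
def heatKernel {n : ℕ} (α t : ℝ) : E n → ℂ :=
  𝓕⁻ (fun ξ : E n => ((Real.exp (-t * (2 * Real.pi * ‖ξ‖) ^ α) : ℝ) : ℂ))

/-- The fractional heat semigroup `T_{α,t} f (x) = ∫ K_α(x - z, t) f(z) dz`. -/
def heat {n : ℕ} (α t : ℝ) (f : E n → ℝ) : E n → ℂ :=
  fun x => ∫ z, heatKernel α t (x - z) * (f z : ℂ)

/-- For bounded functions `g` and `h`, the identity `(-Δ)^{β/2} g = h` in the distributional sense,
that is, `𝓕 h = |2πξ|^β 𝓕 g`. A distribution is Fourier transformed by transposition, so both sides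
are tested on a Schwartz function `ψ`: `⟨h, 𝓕 ψ⟩ = ⟨g, 𝓕 (|2πξ|^β ψ)⟩`. For `β > 0` the function
`𝓕 (|2πξ|^β ψ)` is integrable, so the pairing with `g` makes sense. -/
def IsFracLaplacian {n : ℕ} (β : ℝ) (g h : E n → ℂ) : Prop :=
  ∀ ψ : 𝓢(E n, ℂ),
    ∫ x, h x * 𝓕 (fun ξ : E n => ψ ξ) x =
      ∫ x, g x * 𝓕 (fun ξ : E n => (((2 * Real.pi * ‖ξ‖) ^ β : ℝ) : ℂ) * ψ ξ) x

/-- The norm `‖(-Δ)^{β/2} g‖_∞` in `[0, ∞]` of the distribution `(-Δ)^{β/2} g`: the `L^∞` norm of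
the function representing it (which is unique up to a null set), and `∞` if it is not represented
by a function in `L^∞`. -/
def fracLaplacianNorm {n : ℕ} (β : ℝ) (g : E n → ℂ) : ℝ≥0∞ :=
  ⨅ (h : E n → ℂ) (_ : MemLp h ∞ volume) (_ : IsFracLaplacian β g h), eLpNorm h ∞ volume

/-- `sup_{t > 0} t^{r - s/α} ‖(-Δ)^{αr/2} T_{α,t} f‖_∞`, with values in `[0, ∞]`. -/
def heatSup {n : ℕ} (α s : ℝ) (r : ℕ) (f : E n → ℝ) : ℝ≥0∞ :=
  ⨆ (t : ℝ) (_ : 0 < t),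
    ENNReal.ofReal (t ^ ((r : ℝ) - s / α)) * fracLaplacianNorm (α * r) (heat α t f)

end FracHeat

end

noncomputable section

namespace FracHeat

open Filter Topology
open scoped BoundedContinuousFunction

variable {n : ℕ}

/-! ### Convolution of integrable kernels with bounded continuous functions -/

/-! Write A = (-Δ)^{α/2}, k = ⌊s⌋ + 1, β = αr. Every operator used is a convolution of a bounded
continuous function with an integrable kernel, labelled by its symbol. Products of symbols are
compositions (`op_mul`), and dilation preserves the L¹ norm of the kernel, so estimates uniform in t
reduce to one kernel being integrable.

Integrability of kernels. The symbols |ξ|^b exp(-|ξ|^a) need not be smooth at 0, so it cannot simply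
be obtained by differentiating the symbol. Repeated integration by parts writes F(ρ) = ∫_ρ^∞ (1 -
ρ/u)^M W(u) du/u (`IsEulerSpace.exists_representation`). With ρ = |ξ|² and M = n + 2 this is a
superposition of dilated Bochner–Riesz symbols, whose kernels share one L¹ norm, so ∫|W| du/u < ∞
suffices. The same device handles |ξ|^β ψ for Schwartz ψ, which identifies the distributional norm
of (-Δ)^{β/2} T_{α,t} f with the sup norm of a convolution (`fracLaplacianNorm_heat`).

From S(f) to differences (`exists_norm_bdiff_pow_le_of_heat`). The operator P_t = e^{-tA} ∑_{j<r}
(tA)^j/j! has derivative -t^{r-1}/(r-1)! A^r e^{-tA}. It tends to the identity pointwise as t → 0,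
while Δ_h^k P_t f → 0 as t → ∞. Hence Δ_h^k f is the integral over u > 0 of u^{r-1}/(r-1)! A^r
e^{-uA} Δ_h^k f. Up to a constant the integrand is at most S(f) u^{s/α-1} min(1, (|h| u^{-1/α})^k),
and since 0 < s < k the integral is O(S(f) |h|^s).

From differences to S(f) (`exists_norm_op_heatSymbol_le_of_bdiff`). Averaging Δ_{δy}^{2k} f over y
against a Schwartz kernel produces an operator B_δ with ‖f - B_δ f‖ = O(δ^s), whereas A^r e^{-tA}
B_δ has norm O(δ^{-β}) uniformly in t. Telescoping B_δ² f over the scales 2^j δ with δ = t^{1/α}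
gives terms (2^j δ)^{s-β}, a convergent geometric series because s < β. -/

lemma integrable_kernel_mul {k : E n → ℂ} (hk : Integrable k) (f : E n →ᵇ ℂ) (x : E n) :
    Integrable (fun y => k y * f (x - y)) := by
  refine hk.mul_bdd (c := ‖f‖) ?_ (Eventually.of_forall fun y => f.norm_coe_le_norm _)
  exact (f.continuous.comp (by fun_prop)).aestronglyMeasurable

lemma norm_integral_kernel_le {k : E n → ℂ} (hk : Integrable k) (f : E n →ᵇ ℂ) (x : E n) :
    ‖∫ y, k y * f (x - y)‖ ≤ (∫ y, ‖k y‖) * ‖f‖ := by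
  refine (norm_integral_le_integral_norm _).trans ?_
  rw [← integral_mul_const]
  refine integral_mono (integrable_kernel_mul hk f x).norm (hk.norm.mul_const _) fun y => ?_
  simp only [norm_mul]
  gcongr
  exact f.norm_coe_le_norm _

/-- Convolution of an integrable kernel with a bounded continuous function. -/
def conv (k : E n → ℂ) (f : E n →ᵇ ℂ) : E n →ᵇ ℂ :=
  open Classical in
  if hk : Integrable k then
    BoundedContinuousFunction.ofNormedAddCommGroup (fun x => ∫ y, k y * f (x - y))
      (by
        refine continuous_of_dominated (bound := fun y => ‖k y‖ * ‖f‖) ?_ ?_ ?_ ?_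
        · exact fun x => (integrable_kernel_mul hk f x).aestronglyMeasurable
        · intro x
          refine Eventually.of_forall fun y => ?_
          rw [norm_mul]
          gcongr
          exact f.norm_coe_le_norm _
        · exact hk.norm.mul_const _
        · exact Eventually.of_forall fun y => continuous_const.mul
            (f.continuous.comp (by fun_prop)))
      ((∫ y, ‖k y‖) * ‖f‖) (norm_integral_kernel_le hk f)
  else 0

lemma conv_apply {k : E n → ℂ} (hk : Integrable k) (f : E n →ᵇ ℂ) (x : E n) :
    conv k f x = ∫ y, k y * f (x - y) := by
  simp [conv, hk]

lemma conv_apply' {k : E n → ℂ} (hk : Integrable k) (f : E n →ᵇ ℂ) (x : E n) :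
    conv k f x = ∫ z, k (x - z) * f z := by
  rw [conv_apply hk, ← integral_sub_left_eq_self _ _ x]
  simp

lemma norm_conv_le {k : E n → ℂ} (hk : Integrable k) (f : E n →ᵇ ℂ) :
    ‖conv k f‖ ≤ (∫ y, ‖k y‖) * ‖f‖ := by
  refine (BoundedContinuousFunction.norm_le (by positivity)).2 fun x => ?_
  rw [conv_apply hk]
  exact norm_integral_kernel_le hk f x

lemma conv_add_right {k : E n → ℂ} (hk : Integrable k) (f g : E n →ᵇ ℂ) :
    conv k (f + g) = conv k f + conv k g := by
  ext x
  simp only [BoundedContinuousFunction.add_apply, conv_apply hk, mul_add]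
  exact integral_add (integrable_kernel_mul hk f x) (integrable_kernel_mul hk g x)

lemma conv_smul_right {k : E n → ℂ} (hk : Integrable k) (c : ℂ) (f : E n →ᵇ ℂ) :
    conv k (c • f) = c • conv k f := by
  ext x
  simp only [BoundedContinuousFunction.smul_apply, conv_apply hk, smul_eq_mul]
  rw [← integral_const_mul]
  congr 1 with y
  ring

/-- Convolution with an integrable kernel as a linear map. -/
def convL (k : E n → ℂ) (hk : Integrable k) : (E n →ᵇ ℂ) →ₗ[ℂ] (E n →ᵇ ℂ) where
  toFun := conv k
  map_add' := conv_add_right hk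
  map_smul' := conv_smul_right hk

lemma conv_sub_right {k : E n → ℂ} (hk : Integrable k) (f g : E n →ᵇ ℂ) :
    conv k (f - g) = conv k f - conv k g :=
  (convL k hk).map_sub f g

/-! ### Fourier multipliers with integrable kernel -/

/-- A continuous integrable symbol whose inverse Fourier transform is integrable. -/
structure IsGood (m : E n → ℂ) : Prop where
  cont : Continuous m
  int : Integrable m
  inv : Integrable (𝓕⁻ m)

lemma IsGood.fourier_inv {m : E n → ℂ} (hm : IsGood m) : 𝓕 (𝓕⁻ m) = m := by
  refine hm.cont.fourier_fourierInv_eq hm.int ?_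
  have := hm.inv.comp_neg
  refine this.congr (Eventually.of_forall fun x => ?_)
  simp [Real.fourierInv_eq_fourier_neg]

lemma IsGood.eq_integral {m : E n → ℂ} (hm : IsGood m) (ξ : E n) :
    m ξ = ∫ y, (𝐞 (-inner ℝ y ξ) : ℂ) * 𝓕⁻ m y := by
  conv_lhs => rw [← hm.fourier_inv]
  rw [Real.fourier_eq]
  simp [Circle.smul_def]

lemma IsGood.continuous_inv {m : E n → ℂ} (hm : IsGood m) : Continuous (𝓕⁻ m) := by
  have h : Continuous (𝓕 m) := VectorFourier.fourierIntegral_continuous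
    Real.continuous_fourierChar (by exact continuous_inner) hm.int
  have h2 : 𝓕⁻ m = fun x => 𝓕 m (-x) := by
    ext x; rw [Real.fourierInv_eq_fourier_neg]
  rw [h2]
  exact h.comp continuous_neg

lemma fourierInv_apply (m : E n → ℂ) (x : E n) :
    𝓕⁻ m x = ∫ ξ, (𝐞 (inner ℝ ξ x) : ℂ) * m ξ := by
  rw [Real.fourierInv_eq]
  simp [Circle.smul_def]

lemma continuous_char {X : Type*} [TopologicalSpace X] {g : X → ℝ} (hg : Continuous g) :
    Continuous fun x => (𝐞 (g x) : ℂ) :=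
  continuous_subtype_val.comp (Real.continuous_fourierChar.comp hg)

lemma norm_char (t : ℝ) : ‖(𝐞 t : ℂ)‖ = 1 := Circle.norm_coe _

lemma integrable_char_mul {m : E n → ℂ} (hm : Integrable m) {g : E n → ℝ} (hg : Continuous g) :
    Integrable (fun ξ => (𝐞 (g ξ) : ℂ) * m ξ) := by
  exact hm.bdd_mul (c := 1) (continuous_char hg).aestronglyMeasurable
    (Eventually.of_forall fun y => (norm_char _).le)

lemma IsGood.norm_le {m : E n → ℂ} (hm : IsGood m) (ξ : E n) : ‖m ξ‖ ≤ ∫ y, ‖𝓕⁻ m y‖ := by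
  rw [hm.eq_integral]
  refine (norm_integral_le_integral_norm _).trans (le_of_eq ?_)
  simp [norm_char]

/-- Fubini: m₁ is the Fourier transform of its integrable kernel, and its character shifts x to x -
y in the inversion integral of m₂. -/
lemma fourierInv_mul {m₁ m₂ : E n → ℂ} (h₁ : IsGood m₁) (h₂ : IsGood m₂) (x : E n) :
    𝓕⁻ (fun ξ => m₁ ξ * m₂ ξ) x = ∫ y, 𝓕⁻ m₁ y * 𝓕⁻ m₂ (x - y) := by
  rw [fourierInv_apply]
  have e1 : ∀ ξ, (𝐞 (inner ℝ ξ x) : ℂ) * (m₁ ξ * m₂ ξ) =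
      ∫ y, (𝐞 (inner ℝ ξ (x - y)) : ℂ) * (𝓕⁻ m₁ y * m₂ ξ) := by
    intro ξ
    rw [h₁.eq_integral, ← integral_mul_const, ← integral_const_mul]
    congr 1 with y
    rw [inner_sub_right, sub_eq_add_neg, AddChar.map_add_eq_mul, real_inner_comm y ξ]
    push_cast
    ring
  simp_rw [e1]
  rw [integral_integral_swap]
  · congr 1 with y
    rw [fourierInv_apply m₂, ← integral_const_mul]
    congr 1 with ξ
    ring
  · have : Integrable (Function.uncurry fun (ξ y : E n) => 𝓕⁻ m₁ y * m₂ ξ)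
        (volume.prod volume) := by
      have := (h₂.int.mul_prod h₁.inv)
      refine this.congr (Eventually.of_forall fun p => ?_)
      simp [Function.uncurry, mul_comm]
    exact this.bdd_mul (c := 1) (f := fun p : E n × E n => (𝐞 (inner ℝ p.1 (x - p.2)) : ℂ))
      (continuous_char (by fun_prop)).aestronglyMeasurable
      (Eventually.of_forall fun y => (norm_char _).le)

lemma IsGood.mul {m₁ m₂ : E n → ℂ} (h₁ : IsGood m₁) (h₂ : IsGood m₂) :
    IsGood (fun ξ => m₁ ξ * m₂ ξ) where
  cont := h₁.cont.mul h₂.cont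
  int := h₂.int.bdd_mul (c := ∫ y, ‖𝓕⁻ m₁ y‖) h₁.cont.aestronglyMeasurable
    (Eventually.of_forall h₁.norm_le)
  inv := by
    have := h₁.inv.integrable_convolution (ContinuousLinearMap.mul ℂ ℂ) h₂.inv
    refine this.congr (Eventually.of_forall fun x => ?_)
    rw [fourierInv_mul h₁ h₂]
    simp [MeasureTheory.convolution]

lemma fourierInv_add {m₁ m₂ : E n → ℂ} (h₁ : Integrable m₁) (h₂ : Integrable m₂) :
    𝓕⁻ (fun ξ => m₁ ξ + m₂ ξ) = fun x => 𝓕⁻ m₁ x + 𝓕⁻ m₂ x := by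
  ext x
  simp only [fourierInv_apply, mul_add]
  exact integral_add (integrable_char_mul h₁ (by fun_prop)) (integrable_char_mul h₂ (by fun_prop))

lemma fourierInv_const_mul (c : ℂ) (m : E n → ℂ) :
    𝓕⁻ (fun ξ => c * m ξ) = fun x => c * 𝓕⁻ m x := by
  ext x
  simp only [fourierInv_apply]
  rw [← integral_const_mul]
  congr 1 with ξ
  ring

lemma IsGood.add {m₁ m₂ : E n → ℂ} (h₁ : IsGood m₁) (h₂ : IsGood m₂) :
    IsGood (fun ξ => m₁ ξ + m₂ ξ) where
  cont := h₁.cont.add h₂.cont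
  int := h₁.int.add h₂.int
  inv := by
    rw [fourierInv_add h₁.int h₂.int]
    exact h₁.inv.add h₂.inv

lemma IsGood.const_mul {m : E n → ℂ} (c : ℂ) (h : IsGood m) : IsGood (fun ξ => c * m ξ) where
  cont := continuous_const.mul h.cont
  int := h.int.const_mul c
  inv := by
    rw [fourierInv_const_mul]
    exact h.inv.const_mul c

lemma isGood_zero : IsGood (fun _ : E n => (0 : ℂ)) where
  cont := continuous_const
  int := integrable_zero _ _ _
  inv := by
    have : (𝓕⁻ (fun _ : E n => (0 : ℂ))) = fun _ => 0 := by
      ext x; simp [fourierInv_apply]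
    rw [this]
    exact integrable_zero _ _ _

lemma IsGood.sum {ι : Type*} {s : Finset ι} {m : ι → E n → ℂ} (h : ∀ i ∈ s, IsGood (m i)) :
    IsGood (fun ξ => ∑ i ∈ s, m i ξ) := by
  classical
  induction s using Finset.induction_on with
  | empty => simpa using isGood_zero
  | insert a s ha ih =>
    simp only [Finset.sum_insert ha]
    exact (h a (by simp)).add (ih fun i hi => h i (by simp [hi]))

/-! ### Dilations of symbols -/

lemma fourierInv_dilate (m : E n → ℂ) {l : ℝ} (hl : l ≠ 0) (x : E n) :
    𝓕⁻ (fun ξ => m (l • ξ)) x = ((|l| ^ n)⁻¹ : ℝ) • 𝓕⁻ m (l⁻¹ • x) := by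
  rw [fourierInv_apply, fourierInv_apply]
  have := Measure.integral_comp_smul (volume : Measure (E n))
    (fun ξ => (𝐞 (inner ℝ ξ (l⁻¹ • x)) : ℂ) * m ξ) l
  simp only [finrank_euclideanSpace, Fintype.card_fin] at this
  rw [abs_inv, abs_pow] at this
  rw [← this]
  congr 1 with ξ
  rw [inner_smul_left, inner_smul_right]
  simp [hl]

lemma integral_fourierInv_dilate (m : E n → ℂ) {l : ℝ} (hl : l ≠ 0) (g : E n → ℂ) :
    ∫ x, 𝓕⁻ (fun ξ => m (l • ξ)) x * g x = ∫ y, 𝓕⁻ m y * g (l • y) := by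
  have := Measure.integral_comp_smul (volume : Measure (E n))
    (fun x => 𝓕⁻ m (l⁻¹ • x) * g x) l
  simp only [finrank_euclideanSpace, Fintype.card_fin, smul_smul, inv_mul_cancel₀ hl, one_smul]
    at this
  rw [this, ← integral_smul]
  congr 1 with x
  rw [fourierInv_dilate m hl, abs_inv, abs_pow]
  simp [mul_assoc]

/-- The source of all uniformity: constants depend neither on the time t, nor on the Bochner–Riesz
parameter u, nor on the averaging scale δ. -/
lemma integral_norm_fourierInv_dilate (m : E n → ℂ) {l : ℝ} (hl : l ≠ 0) :
    ∫ x, ‖𝓕⁻ (fun ξ => m (l • ξ)) x‖ = ∫ y, ‖𝓕⁻ m y‖ := by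
  have := Measure.integral_comp_smul (volume : Measure (E n))
    (fun x => ‖𝓕⁻ m (l⁻¹ • x)‖) l
  simp only [finrank_euclideanSpace, Fintype.card_fin, smul_smul, inv_mul_cancel₀ hl, one_smul]
    at this
  rw [this, ← integral_smul]
  congr 1 with x
  rw [fourierInv_dilate m hl, abs_inv, abs_pow, norm_smul]
  simp

lemma integral_norm_fourierInv_dilate_sub (m : E n → ℂ) {l : ℝ} (hl : l ≠ 0) (h : E n) :
    ∫ x, ‖𝓕⁻ (fun ξ => m (l • ξ)) (x + h) - 𝓕⁻ (fun ξ => m (l • ξ)) x‖ =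
      ∫ x, ‖𝓕⁻ m (x + l⁻¹ • h) - 𝓕⁻ m x‖ := by
  have := Measure.integral_comp_smul (volume : Measure (E n))
    (fun x => ‖𝓕⁻ m (l⁻¹ • (x + h)) - 𝓕⁻ m (l⁻¹ • x)‖) l
  simp only [finrank_euclideanSpace, Fintype.card_fin, smul_add, smul_smul, inv_mul_cancel₀ hl,
    one_smul] at this
  rw [this, ← integral_smul]
  congr 1 with x
  rw [fourierInv_dilate m hl, fourierInv_dilate m hl, abs_inv, abs_pow, ← smul_sub, norm_smul,
    smul_add]
  simp

lemma IsGood.dilate {m : E n → ℂ} (h : IsGood m) {l : ℝ} (hl : l ≠ 0) :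
    IsGood (fun ξ => m (l • ξ)) where
  cont := h.cont.comp (by fun_prop)
  int := h.int.comp_smul hl
  inv := by
    have : 𝓕⁻ (fun ξ => m (l • ξ)) = fun x => ((|l| ^ n)⁻¹ : ℝ) • 𝓕⁻ m (l⁻¹ • x) := by
      ext x; exact fourierInv_dilate m hl x
    rw [this]
    exact (h.inv.comp_smul (inv_ne_zero hl)).smul ((|l| ^ n)⁻¹ : ℝ)

/-- The operator with Fourier symbol `m`. -/
def op (m : E n → ℂ) (f : E n →ᵇ ℂ) : E n →ᵇ ℂ := conv (𝓕⁻ m) f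

lemma IsGood.norm_op_le {m : E n → ℂ} (h : IsGood m) (f : E n →ᵇ ℂ) :
    ‖op m f‖ ≤ (∫ y, ‖𝓕⁻ m y‖) * ‖f‖ := norm_conv_le h.inv f

lemma IsGood.op_add {m : E n → ℂ} (h : IsGood m) (f g : E n →ᵇ ℂ) :
    op m (f + g) = op m f + op m g := conv_add_right h.inv f g

lemma IsGood.op_sub {m : E n → ℂ} (h : IsGood m) (f g : E n →ᵇ ℂ) :
    op m (f - g) = op m f - op m g := conv_sub_right h.inv f g

/-- Associativity of convolution, by Fubini: both kernels are integrable and f is bounded, so no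
decay of f is needed. -/
lemma op_mul {m₁ m₂ : E n → ℂ} (h₁ : IsGood m₁) (h₂ : IsGood m₂) (f : E n →ᵇ ℂ) :
    op (fun ξ => m₁ ξ * m₂ ξ) f = op m₁ (op m₂ f) := by
  ext x
  unfold op
  rw [conv_apply (h₁.mul h₂).inv, conv_apply h₁.inv]
  have e1 : ∀ y, 𝓕⁻ m₁ y * conv (𝓕⁻ m₂) f (x - y) =
      ∫ w, 𝓕⁻ m₁ y * 𝓕⁻ m₂ (w - y) * f (x - w) := by
    intro y
    rw [conv_apply h₂.inv, ← integral_sub_right_eq_self _ y, ← integral_const_mul]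
    congr 1 with w
    rw [show x - y - (w - y) = x - w by abel]
    ring
  simp_rw [e1]
  rw [integral_integral_swap]
  · congr 1 with w
    rw [fourierInv_mul h₁ h₂, ← integral_mul_const]
  · have h3 : Integrable (fun p : E n × E n => 𝓕⁻ m₁ p.1 * 𝓕⁻ m₂ (p.2 - p.1))
        (volume.prod volume) := by
      have := (h₁.inv.convolution_integrand (ContinuousLinearMap.mul ℂ ℂ) h₂.inv).swap
      exact this
    refine h3.mul_bdd (c := ‖f‖) ?_ (Eventually.of_forall fun p => f.norm_coe_le_norm _)
    exact (f.continuous.comp (by fun_prop)).aestronglyMeasurable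

lemma op_add_left {m₁ m₂ : E n → ℂ} (h₁ : IsGood m₁) (h₂ : IsGood m₂) (f : E n →ᵇ ℂ) :
    op (fun ξ => m₁ ξ + m₂ ξ) f = op m₁ f + op m₂ f := by
  ext x
  simp only [op, BoundedContinuousFunction.add_apply]
  rw [conv_apply (h₁.add h₂).inv, conv_apply h₁.inv, conv_apply h₂.inv,
    ← integral_add (integrable_kernel_mul h₁.inv f x) (integrable_kernel_mul h₂.inv f x),
    fourierInv_add h₁.int h₂.int]
  simp only [add_mul]

lemma op_const_mul {m : E n → ℂ} (c : ℂ) (h : IsGood m) (f : E n →ᵇ ℂ) :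
    op (fun ξ => c * m ξ) f = c • op m f := by
  ext x
  simp only [op, BoundedContinuousFunction.smul_apply]
  rw [conv_apply (h.const_mul c).inv, conv_apply h.inv, smul_eq_mul, ← integral_const_mul,
    fourierInv_const_mul]
  simp only [mul_assoc]

lemma op_sum_left {ι : Type*} {s : Finset ι} {m : ι → E n → ℂ} (h : ∀ i ∈ s, IsGood (m i))
    (f : E n →ᵇ ℂ) : op (fun ξ => ∑ i ∈ s, m i ξ) f = ∑ i ∈ s, op (m i) f := by
  classical
  induction s using Finset.induction_on with
  | empty =>
    ext x
    simp only [op, Finset.sum_empty, conv_apply isGood_zero.inv]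
    simp [fourierInv_apply]
  | insert a s ha ih =>
    simp only [Finset.sum_insert ha]
    rw [op_add_left (h a (by simp)) (IsGood.sum fun i hi => h i (by simp [hi])),
      ih fun i hi => h i (by simp [hi])]

lemma op_dilate_apply {m : E n → ℂ} (h : IsGood m) {l : ℝ} (hl : l ≠ 0) (f : E n →ᵇ ℂ)
    (x : E n) : op (fun ξ => m (l • ξ)) f x = ∫ y, 𝓕⁻ m y * f (x - l • y) := by
  rw [op, conv_apply (h.dilate hl).inv, integral_fourierInv_dilate m hl fun y => f (x - y)]

lemma IsGood.norm_op_dilate_le {m : E n → ℂ} (h : IsGood m) {l : ℝ} (hl : l ≠ 0)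
    (f : E n →ᵇ ℂ) : ‖op (fun ξ => m (l • ξ)) f‖ ≤ (∫ y, ‖𝓕⁻ m y‖) * ‖f‖ := by
  rw [← integral_norm_fourierInv_dilate m hl]
  exact (h.dilate hl).norm_op_le f

/-! ### The Bochner–Riesz kernel -/

lemma hasDerivAt_max_zero_pow (k : ℕ) (x : ℝ) :
    HasDerivAt (fun y : ℝ => (max y 0) ^ (k + 2)) ((k + 2) * (max x 0) ^ (k + 1)) x := by
  rcases lt_trichotomy x 0 with hx | rfl | hx
  · have h0 : HasDerivAt (fun _ : ℝ => (0 : ℝ)) 0 x := hasDerivAt_const _ _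
    rw [max_eq_right hx.le]
    simp only [ne_eq, Nat.add_eq_zero_iff, one_ne_zero, and_false, not_false_eq_true, zero_pow,
      mul_zero]
    refine h0.congr_of_eventuallyEq ?_
    filter_upwards [Iio_mem_nhds hx] with y hy
    rw [max_eq_right (le_of_lt hy)]
    simp
  · simp only [max_self, ne_eq, Nat.add_eq_zero_iff, one_ne_zero, and_false, not_false_eq_true,
      zero_pow, mul_zero]
    rw [hasDerivAt_iff_isLittleO]
    simp only [max_self, ne_eq, Nat.add_eq_zero_iff, OfNat.ofNat_ne_zero, and_false,
      not_false_eq_true, zero_pow, sub_zero, smul_zero]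
    have h1 : (fun y : ℝ => (max y 0) ^ (k + 2)) =O[𝓝 0] fun y => y ^ (k + 2) := by
      refine Asymptotics.IsBigO.of_bound 1 (Eventually.of_forall fun y => ?_)
      rw [one_mul, norm_pow, norm_pow]
      gcongr
      rw [Real.norm_eq_abs, Real.norm_eq_abs, abs_of_nonneg (le_max_right _ _)]
      exact max_le (le_abs_self y) (abs_nonneg y)
    refine h1.trans_isLittleO ?_
    have := Asymptotics.isLittleO_pow_pow (𝕜 := ℝ) (show 1 < k + 2 by omega)
    simpa using this
  · rw [max_eq_left hx.le]
    have h0 := hasDerivAt_pow (k + 2) x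
    simp only [Nat.cast_add, Nat.cast_ofNat, Nat.add_succ_sub_one] at h0
    refine h0.congr_of_eventuallyEq ?_
    filter_upwards [Ioi_mem_nhds hx] with y hy
    rw [max_eq_left (le_of_lt hy)]

lemma contDiff_max_zero_pow (k : ℕ) : ContDiff ℝ k (fun y : ℝ => (max y 0) ^ (k + 1)) := by
  induction k with
  | zero =>
    simp only [Nat.cast_zero, contDiff_zero]
    fun_prop
  | succ k ih =>
    have hd : deriv (fun y : ℝ => (max y 0) ^ (k + 2)) =
        fun x => ((k : ℝ) + 2) * (max x 0) ^ (k + 1) := by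
      ext x; exact (hasDerivAt_max_zero_pow k x).deriv
    push_cast
    rw [contDiff_succ_iff_deriv]
    refine ⟨fun x => (hasDerivAt_max_zero_pow k x).differentiableAt, by simp, ?_⟩
    rw [hd]
    exact contDiff_const.mul ih

/-- The Bochner–Riesz symbol `(1 - |ξ|²)₊ ^ (n + 2)`. -/
def brSymbol (n : ℕ) (ξ : E n) : ℂ := (((max (1 - ‖ξ‖ ^ 2) 0) ^ (n + 2) : ℝ) : ℂ)

/-- The exponent n + 2 is chosen for these n + 1 derivatives: they give the kernel the integrable
decay (1 + |x|)^{-(n+1)}. -/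
lemma contDiff_brSymbol : ContDiff ℝ ((n + 1 : ℕ) : ℕ∞) (brSymbol n) := by
  refine Complex.ofRealCLM.contDiff.comp ?_
  exact (contDiff_max_zero_pow (n + 1)).comp (contDiff_const.sub (contDiff_norm_sq ℝ))

lemma hasCompactSupport_brSymbol : HasCompactSupport (brSymbol n) := by
  refine HasCompactSupport.intro (isCompact_closedBall 0 1) fun x hx => ?_
  have : 1 < ‖x‖ := by simpa using hx
  have h2 : 1 - ‖x‖ ^ 2 ≤ 0 := by nlinarith
  simp [brSymbol, max_eq_right h2]

lemma fourierInv_brSymbol : 𝓕⁻ (brSymbol n) = 𝓕 (brSymbol n) := by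
  rw [Real.fourierInv_eq_fourier_comp_neg]
  congr 1
  ext ξ
  simp [brSymbol]

lemma exists_pow_mul_norm_fourier_brSymbol_le {k j : ℕ} (hj : j ≤ n + 1) :
    ∃ C : ℝ, 0 ≤ C ∧
      ∀ x : E n, ‖x‖ ^ j * ‖iteratedFDeriv ℝ k (𝓕 (brSymbol n)) x‖ ≤ C := by
  have hint : ∀ (a b : ℕ), (a : ℕ∞) ≤ (k : ℕ∞) → (b : ℕ∞) ≤ ((n + 1 : ℕ) : ℕ∞) →
      Integrable (fun v => ‖v‖ ^ a * ‖iteratedFDeriv ℝ b (brSymbol n) v‖) := by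
    intro a b _ hb
    have hc : Continuous (iteratedFDeriv ℝ b (brSymbol n)) :=
      contDiff_brSymbol.continuous_iteratedFDeriv (by exact_mod_cast hb)
    refine Continuous.integrable_of_hasCompactSupport (by fun_prop) ?_
    exact ((hasCompactSupport_brSymbol.iteratedFDeriv b).norm).mul_left
  refine ⟨_, ?_, fun x => Real.pow_mul_norm_iteratedFDeriv_fourier_le (K := k)
    contDiff_brSymbol hint le_rfl (by exact_mod_cast hj) x⟩
  positivity

/-- Combines the weights |x|^0 and |x|^{n+1}. The case k = 0 yields integrability of the kernel, k =
1 its Lipschitz continuity under translation in L¹. -/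
lemma exists_norm_iteratedFDeriv_fourier_brSymbol_le (k : ℕ) :
    ∃ C : ℝ, 0 ≤ C ∧ ∀ x : E n,
      ‖iteratedFDeriv ℝ k (𝓕 (brSymbol n)) x‖ ≤ C * (1 + ‖x‖) ^ (-(n + 1 : ℝ)) := by
  obtain ⟨C₀, h₀, hC₀⟩ := exists_pow_mul_norm_fourier_brSymbol_le (n := n) (k := k) (j := 0)
    (by omega)
  obtain ⟨C₁, h₁, hC₁⟩ := exists_pow_mul_norm_fourier_brSymbol_le (n := n) (k := k) (j := n + 1)
    le_rfl
  refine ⟨2 ^ n * (C₀ + C₁), by positivity, fun x => ?_⟩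
  rw [Real.rpow_neg (by positivity), ← div_eq_mul_inv, le_div_iff₀ (by positivity)]
  have e : (1 + ‖x‖) ^ ((n : ℝ) + 1) = (1 + ‖x‖) ^ (n + 1) := by
    exact_mod_cast Real.rpow_natCast (1 + ‖x‖) (n + 1)
  rw [e]
  have := add_pow_le zero_le_one (norm_nonneg x) (n + 1)
  simp only [one_pow, Nat.add_sub_cancel] at this
  calc _ ≤ ‖iteratedFDeriv ℝ k (𝓕 (brSymbol n)) x‖ * (2 ^ n * (1 + ‖x‖ ^ (n + 1))) := by gcongr
    _ = 2 ^ n * (‖x‖ ^ 0 * ‖iteratedFDeriv ℝ k (𝓕 (brSymbol n)) x‖ +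
        ‖x‖ ^ (n + 1) * ‖iteratedFDeriv ℝ k (𝓕 (brSymbol n)) x‖) := by ring
    _ ≤ _ := by gcongr; exacts [hC₀ x, hC₁ x]

lemma integrable_one_add_norm_neg : Integrable (fun x : E n => (1 + ‖x‖) ^ (-(n + 1 : ℝ))) :=
  integrable_one_add_norm (by simp)

lemma isGood_brSymbol : IsGood (brSymbol n) where
  cont := contDiff_brSymbol.continuous
  int := contDiff_brSymbol.continuous.integrable_of_hasCompactSupport hasCompactSupport_brSymbol
  inv := by
    rw [fourierInv_brSymbol]
    obtain ⟨C, _, hC⟩ := exists_norm_iteratedFDeriv_fourier_brSymbol_le (n := n) 0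
    simp only [norm_iteratedFDeriv_zero] at hC
    refine (integrable_one_add_norm_neg.const_mul C).mono' ?_ (Eventually.of_forall hC)
    have h : Continuous (𝓕 (brSymbol n)) := VectorFourier.fourierIntegral_continuous
      Real.continuous_fourierChar (by exact continuous_inner)
      (contDiff_brSymbol.continuous.integrable_of_hasCompactSupport hasCompactSupport_brSymbol)
    exact h.aestronglyMeasurable

lemma differentiable_fourier_brSymbol : Differentiable ℝ (𝓕 (brSymbol n)) := by
  refine Real.differentiable_fourier isGood_brSymbol.int ?_
  refine Continuous.integrable_of_hasCompactSupport (f := fun v => ‖v‖ * ‖brSymbol n v‖)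
    (continuous_norm.mul isGood_brSymbol.cont.norm) ?_
  exact hasCompactSupport_brSymbol.norm.mul_left

/-- For |h| ≤ 1 the mean value inequality and the decay of the gradient apply; for |h| ≥ 1 the
triangle inequality is enough. -/
lemma exists_integral_norm_sub_brSymbol_le :
    ∃ C : ℝ, 0 ≤ C ∧ ∀ h : E n,
      ∫ x, ‖𝓕⁻ (brSymbol n) (x + h) - 𝓕⁻ (brSymbol n) x‖ ≤ C * ‖h‖ := by
  set B := 𝓕⁻ (brSymbol n) with hB
  obtain ⟨C, hC0, hC⟩ := exists_norm_iteratedFDeriv_fourier_brSymbol_le (n := n) 1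
  simp only [norm_iteratedFDeriv_one] at hC
  rw [← fourierInv_brSymbol, ← hB] at hC
  have hBi : Integrable B := isGood_brSymbol.inv
  set I := ∫ x : E n, (1 + ‖x‖) ^ (-(n + 1 : ℝ)) with hI
  have hI0 : 0 ≤ I := integral_nonneg fun x => by positivity
  have hJ0 : 0 ≤ ∫ x, ‖B x‖ := integral_nonneg fun x => by positivity
  refine ⟨C * 2 ^ (n + 1) * I + 2 * ∫ x, ‖B x‖, by positivity, fun h => ?_⟩
  rcases le_total ‖h‖ 1 with hh | hh
  · have key : ∀ x, ‖B (x + h) - B x‖ ≤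
        (C * 2 ^ (n + 1) * ‖h‖) * (1 + ‖x‖) ^ (-(n + 1 : ℝ)) := by
      intro x
      have := (convex_closedBall x 1).norm_image_sub_le_of_norm_fderiv_le (𝕜 := ℝ) (f := B)
        (C := C * 2 ^ (n + 1) * (1 + ‖x‖) ^ (-(n + 1 : ℝ))) (x := x) (y := x + h)
        (fun y _ => by rw [hB, fourierInv_brSymbol]; exact differentiable_fourier_brSymbol y)
        (fun y hy => ?_) (by simp) (by simpa using hh)
      · rw [add_sub_cancel_left] at this
        linarith
      · refine (hC y).trans ?_
        rw [mul_assoc]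
        gcongr
        have hy' : ‖y - x‖ ≤ 1 := by simpa [dist_eq_norm] using hy
        -- On the unit ball about x the decay weight changes by a bounded factor, whence 2^(n+1).
        have h1 : (1 + ‖x‖) / 2 ≤ 1 + ‖y‖ := by
          have := norm_sub_norm_le x y
          rw [norm_sub_rev] at this
          linarith [norm_nonneg y]
        calc (1 + ‖y‖) ^ (-(n + 1 : ℝ)) ≤ ((1 + ‖x‖) / 2) ^ (-(n + 1 : ℝ)) :=
              Real.rpow_le_rpow_of_nonpos (by positivity) h1 (by linarith [n.cast_nonneg (α := ℝ)])
          _ = _ := by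
              have e : (2 : ℝ) ^ ((n : ℝ) + 1) = 2 ^ (n + 1) := by
                rw [← Nat.cast_succ, Real.rpow_natCast]
              rw [Real.div_rpow (by positivity) (by positivity), Real.rpow_neg (x := 2) (by norm_num),
                div_inv_eq_mul, mul_comm, e]
    calc ∫ x, ‖B (x + h) - B x‖
        ≤ ∫ x, (C * 2 ^ (n + 1) * ‖h‖) * (1 + ‖x‖) ^ (-(n + 1 : ℝ)) :=
          integral_mono ((hBi.comp_add_right h).sub hBi).norm
            (integrable_one_add_norm_neg.const_mul _) key
      _ = C * 2 ^ (n + 1) * I * ‖h‖ := by rw [integral_const_mul]; ring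
      _ ≤ _ := by gcongr; linarith
  · calc ∫ x, ‖B (x + h) - B x‖
        ≤ ∫ x, (‖B (x + h)‖ + ‖B x‖) :=
          integral_mono ((hBi.comp_add_right h).sub hBi).norm
            ((hBi.comp_add_right h).norm.add hBi.norm) fun x => norm_sub_le _ _
      _ = 2 * ∫ x, ‖B x‖ := by
          rw [integral_add (hBi.comp_add_right h).norm hBi.norm,
            integral_add_right_eq_self (fun x => ‖B x‖)]
          ring
      _ ≤ (C * 2 ^ (n + 1) * I + 2 * ∫ x, ‖B x‖) * 1 := by
          have : 0 ≤ C * 2 ^ (n + 1) * I := mul_nonneg (mul_nonneg hC0 (pow_nonneg zero_le_two _)) hI0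
          rw [mul_one]
          exact le_add_of_nonneg_left this
      _ ≤ _ := mul_le_mul_of_nonneg_left hh (add_nonneg
          (mul_nonneg (mul_nonneg hC0 (pow_nonneg zero_le_two _)) hI0)
          (mul_nonneg zero_le_two hJ0))

/-! ### Superpositions of Bochner–Riesz kernels -/

/-- The kernel of the dilated Bochner–Riesz symbol `(1 - |ξ|² / u)₊ ^ (n + 2)`. -/
def brKernel (n : ℕ) (u : ℝ) : E n → ℂ := 𝓕⁻ (fun ξ : E n => brSymbol n ((√u)⁻¹ • ξ))

lemma brKernel_eq {u : ℝ} (hu : 0 < u) (x : E n) :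
    brKernel n u x = (√u ^ n : ℝ) • 𝓕⁻ (brSymbol n) (√u • x) := by
  have h : √u ≠ 0 := by positivity
  rw [brKernel, fourierInv_dilate _ (inv_ne_zero h), inv_inv, abs_of_nonneg (by positivity),
    inv_pow, inv_inv]

lemma isGood_brSymbol_dilate {u : ℝ} (hu : 0 < u) :
    IsGood (fun ξ : E n => brSymbol n ((√u)⁻¹ • ξ)) :=
  isGood_brSymbol.dilate (inv_ne_zero (by positivity))

lemma integrable_brKernel {u : ℝ} (hu : 0 < u) : Integrable (brKernel n u) :=
  (isGood_brSymbol_dilate hu).inv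

lemma integral_norm_brKernel {u : ℝ} (hu : 0 < u) :
    ∫ x, ‖brKernel n u x‖ = ∫ x, ‖𝓕⁻ (brSymbol n) x‖ :=
  integral_norm_fourierInv_dilate _ (inv_ne_zero (by positivity))

lemma integral_norm_brKernel_sub {u : ℝ} (hu : 0 < u) (h : E n) :
    ∫ x, ‖brKernel n u (x + h) - brKernel n u x‖ =
      ∫ x, ‖𝓕⁻ (brSymbol n) (x + √u • h) - 𝓕⁻ (brSymbol n) x‖ := by
  have := integral_norm_fourierInv_dilate_sub (brSymbol n)
    (inv_ne_zero (show √u ≠ 0 by positivity)) h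
  rwa [inv_inv] at this

lemma integral_norm_brSymbol_dilate {u : ℝ} (hu : 0 < u) :
    ∫ ξ, ‖brSymbol n ((√u)⁻¹ • ξ)‖ = √u ^ n * ∫ ξ, ‖brSymbol n ξ‖ := by
  have := Measure.integral_comp_smul (volume : Measure (E n)) (fun x => ‖brSymbol n x‖) (√u)⁻¹
  simp only [finrank_euclideanSpace, Fintype.card_fin] at this
  rw [this, abs_of_nonneg (by positivity), inv_pow, inv_inv, smul_eq_mul]

section Superposition

variable {v : ℝ → ℝ} {m : E n → ℂ}

lemma ae_pos : ∀ᵐ u ∂(volume.restrict (Ioi (0 : ℝ))), 0 < u :=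
  ae_restrict_mem measurableSet_Ioi

lemma integrable_superposition_symbol (hv : IntegrableOn v (Ioi 0))
    (hvn : IntegrableOn (fun u => v u * √u ^ n) (Ioi 0)) :
    Integrable (fun p : E n × ℝ => (v p.2 : ℂ) * brSymbol n ((√p.2)⁻¹ • p.1))
      (volume.prod (volume.restrict (Ioi 0))) := by
  have hmeas : AEStronglyMeasurable
      (fun p : E n × ℝ => (v p.2 : ℂ) * brSymbol n ((√p.2)⁻¹ • p.1))
      (volume.prod (volume.restrict (Ioi 0))) := by
    refine AEStronglyMeasurable.mul
      (Complex.continuous_ofReal.comp_aestronglyMeasurable hv.aestronglyMeasurable.comp_snd) ?_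
    refine (isGood_brSymbol.cont.measurable.comp ?_).aestronglyMeasurable
    fun_prop
  rw [integrable_prod_iff' hmeas]
  constructor
  · filter_upwards [ae_pos] with u hu
    exact (isGood_brSymbol_dilate hu).int.const_mul _
  · refine (hvn.norm.mul_const (∫ ξ, ‖brSymbol n ξ‖)).congr ?_
    filter_upwards [ae_pos] with u hu
    simp only [norm_mul, Complex.norm_real]
    rw [integral_const_mul, integral_norm_brSymbol_dilate hu,
      Real.norm_of_nonneg (show 0 ≤ √u ^ n by positivity)]
    ring

lemma aestronglyMeasurable_brKernel : AEStronglyMeasurable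
    (fun p : E n × ℝ => brKernel n p.2 p.1) (volume.prod (volume.restrict (Ioi 0))) := by
  have h1 : AEStronglyMeasurable
      (fun p : E n × ℝ => (√p.2 ^ n : ℝ) • 𝓕⁻ (brSymbol n) (√p.2 • p.1))
      (volume.prod (volume.restrict (Ioi 0))) := by
    refine Measurable.aestronglyMeasurable ?_
    have h3 : Measurable fun p : E n × ℝ => √p.2 ^ n := by fun_prop
    refine h3.smul ?_
    have h2 : Measurable fun p : E n × ℝ => √p.2 • p.1 := by fun_prop
    exact isGood_brSymbol.continuous_inv.measurable.comp h2
  refine h1.congr ?_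
  have h2 : ∀ᵐ p : E n × ℝ ∂(volume.prod (volume.restrict (Ioi 0))), 0 < p.2 :=
    Measure.quasiMeasurePreserving_snd.ae ae_pos
  filter_upwards [h2] with p hp
  exact (brKernel_eq hp p.1).symm

/-- The L¹ norm of the kernel does not depend on u, so integrability of v alone suffices here. The
weight √u ^ n is needed only for the symbols, to exchange integrals in the inversion formula. -/
lemma integrable_superposition_kernel (hv : IntegrableOn v (Ioi 0)) :
    Integrable (fun p : E n × ℝ => (v p.2 : ℂ) * brKernel n p.2 p.1)
      (volume.prod (volume.restrict (Ioi 0))) := by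
  have hmeas : AEStronglyMeasurable (fun p : E n × ℝ => (v p.2 : ℂ) * brKernel n p.2 p.1)
      (volume.prod (volume.restrict (Ioi 0))) :=
    AEStronglyMeasurable.mul
      (Complex.continuous_ofReal.comp_aestronglyMeasurable hv.aestronglyMeasurable.comp_snd)
      aestronglyMeasurable_brKernel
  rw [integrable_prod_iff' hmeas]
  constructor
  · filter_upwards [ae_pos] with u hu
    exact (integrable_brKernel hu).const_mul _
  · refine (hv.norm.mul_const (∫ ξ, ‖𝓕⁻ (brSymbol n) ξ‖)).congr ?_
    filter_upwards [ae_pos] with u hu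
    simp only [norm_mul, Complex.norm_real]
    rw [integral_const_mul, integral_norm_brKernel hu]

lemma fourierInv_superposition (hv : IntegrableOn v (Ioi 0))
    (hvn : IntegrableOn (fun u => v u * √u ^ n) (Ioi 0))
    (hm : ∀ᵐ ξ, m ξ = ∫ u in Ioi 0, (v u : ℂ) * brSymbol n ((√u)⁻¹ • ξ)) (x : E n) :
    𝓕⁻ m x = ∫ u in Ioi 0, (v u : ℂ) * brKernel n u x := by
  rw [Real.fourierInv_congr_ae hm, fourierInv_apply]
  simp_rw [← integral_const_mul]
  rw [integral_integral_swap]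
  · congr 1 with u
    rw [brKernel, fourierInv_apply, ← integral_const_mul]
    congr 1 with ξ
    ring
  · refine (integrable_superposition_symbol hv hvn).bdd_mul (c := 1)
      (f := fun p : E n × ℝ => (𝐞 (inner ℝ p.1 x) : ℂ))
      (continuous_char (by fun_prop)).aestronglyMeasurable
      (Eventually.of_forall fun y => (norm_char _).le)

lemma isGood_superposition (hv : IntegrableOn v (Ioi 0))
    (hvn : IntegrableOn (fun u => v u * √u ^ n) (Ioi 0)) (hc : Continuous m)
    (hm : ∀ᵐ ξ, m ξ = ∫ u in Ioi 0, (v u : ℂ) * brSymbol n ((√u)⁻¹ • ξ)) : IsGood m where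
  cont := hc
  int := (integrable_superposition_symbol hv hvn).integral_prod_left.congr
    (hm.mono fun _ h => h.symm)
  inv := (integrable_superposition_kernel hv).integral_prod_left.congr
    (Eventually.of_forall fun x => (fourierInv_superposition hv hvn hm x).symm)

/-- Translating the kernel of parameter u by h amounts in L¹ to translating the unit kernel by √u h;
this explains the weight √u. -/
lemma exists_integral_norm_sub_superposition_le (hv : IntegrableOn v (Ioi 0))
    (hvn : IntegrableOn (fun u => v u * √u ^ n) (Ioi 0))
    (hvs : IntegrableOn (fun u => v u * √u) (Ioi 0))
    (hm : ∀ᵐ ξ, m ξ = ∫ u in Ioi 0, (v u : ℂ) * brSymbol n ((√u)⁻¹ • ξ)) :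
    ∃ C : ℝ, 0 ≤ C ∧ ∀ h : E n, ∫ x, ‖𝓕⁻ m (x + h) - 𝓕⁻ m x‖ ≤ C * ‖h‖ := by
  obtain ⟨C, hC0, hC⟩ := exists_integral_norm_sub_brSymbol_le (n := n)
  refine ⟨C * ∫ u in Ioi 0, ‖v u * √u‖,
    mul_nonneg hC0 (integral_nonneg fun _ => norm_nonneg _), fun h => ?_⟩
  have hk := integrable_superposition_kernel (n := n) hv
  have hk' : Integrable (fun p : E n × ℝ => (v p.2 : ℂ) * brKernel n p.2 (p.1 + h))
      (volume.prod (volume.restrict (Ioi 0))) := by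
    have hp : MeasurePreserving (Prod.map (fun x : E n => x + h) (id : ℝ → ℝ))
        (volume.prod (volume.restrict (Ioi 0))) (volume.prod (volume.restrict (Ioi 0))) :=
      (measurePreserving_add_right volume h).prod (MeasurePreserving.id _)
    exact hp.integrable_comp_of_integrable hk
  have hd : Integrable (fun p : E n × ℝ =>
      (v p.2 : ℂ) * (brKernel n p.2 (p.1 + h) - brKernel n p.2 p.1))
      (volume.prod (volume.restrict (Ioi 0))) := by
    refine (hk'.sub hk).congr (Eventually.of_forall fun p => ?_)
    simp [mul_sub]
  calc ∫ x, ‖𝓕⁻ m (x + h) - 𝓕⁻ m x‖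
      ≤ ∫ x, ∫ u in Ioi 0, ‖(v u : ℂ) * (brKernel n u (x + h) - brKernel n u x)‖ := by
        refine integral_mono_ae ?_ hd.norm.integral_prod_left ?_
        · have hi : Integrable (𝓕⁻ m) :=
            (integrable_superposition_kernel hv).integral_prod_left.congr
              (Eventually.of_forall fun x => (fourierInv_superposition hv hvn hm x).symm)
          exact ((hi.comp_add_right h).sub hi).norm
        · filter_upwards [hk.prod_right_ae, hk'.prod_right_ae] with x h1 h2
          rw [fourierInv_superposition hv hvn hm, fourierInv_superposition hv hvn hm,
            ← integral_sub h2 h1]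
          simp only [← mul_sub]
          exact norm_integral_le_integral_norm _
    _ = ∫ u in Ioi 0, ∫ x, ‖(v u : ℂ) * (brKernel n u (x + h) - brKernel n u x)‖ :=
        integral_integral_swap hd.norm
    _ ≤ ∫ u in Ioi 0, C * ‖h‖ * ‖v u * √u‖ := by
        refine integral_mono_ae hd.norm.integral_prod_right (hvs.norm.const_mul _) ?_
        filter_upwards [ae_pos] with u hu
        simp only [norm_mul, Complex.norm_real]
        rw [integral_const_mul, integral_norm_brKernel_sub hu]
        refine (mul_le_mul_of_nonneg_left (hC _) (norm_nonneg _)).trans (le_of_eq ?_)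
        rw [norm_smul]
        ring
    _ = _ := by rw [integral_const_mul]; ring

end Superposition

/-! ### Radial symbols -/

/-- A space of functions on `(0, ∞)` stable under the Euler derivative `u d/du`, with decay
sufficient for Bochner–Riesz superpositions in dimension `n`. -/
structure IsEulerSpace (n : ℕ) (𝓒 : Submodule ℝ (ℝ → ℝ)) : Prop where
  deriv : ∀ F ∈ 𝓒, ∃ G ∈ 𝓒, ∀ u, 0 < u → HasDerivAt F (G u / u) u
  lim : ∀ F ∈ 𝓒, Tendsto F atTop (𝓝 0)
  int : ∀ F ∈ 𝓒, IntegrableOn (fun u => F u / u) (Ioi 0)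
  int_dim : ∀ F ∈ 𝓒, IntegrableOn (fun u => F u / u * √u ^ n) (Ioi 0)

lemma IsEulerSpace.integrableOn_pow {𝓒 : Submodule ℝ (ℝ → ℝ)} (h𝓒 : IsEulerSpace n 𝓒)
    {W : ℝ → ℝ} (hW : W ∈ 𝓒) {ρ : ℝ} (hρ : 0 < ρ) {M : ℕ} :
    IntegrableOn (fun u => (u - ρ) ^ M * (W u / u ^ (M + 1))) (Ioi ρ) := by
  have h1 : IntegrableOn (fun u => W u / u) (Ioi ρ) :=
    (h𝓒.int W hW).mono_set (Ioi_subset_Ioi hρ.le)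
  have h2 : IntegrableOn (fun u => ((u - ρ) / u) ^ M * (W u / u)) (Ioi ρ) := by
    refine Integrable.bdd_mul (c := 1) h1 ?_ ?_
    · exact (Measurable.pow_const (by fun_prop) M).aestronglyMeasurable
    · filter_upwards [ae_restrict_mem measurableSet_Ioi] with u (hu : ρ < u)
      have hu0 : 0 < u := hρ.trans hu
      rw [norm_pow, Real.norm_of_nonneg (div_nonneg (by linarith) hu0.le)]
      refine pow_le_one₀ (div_nonneg (by linarith) hu0.le) ?_
      rw [div_le_one hu0]
      linarith
  refine h2.congr_fun (fun u (hu : ρ < u) => ?_) measurableSet_Ioi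
  have hu0 : 0 < u := hρ.trans hu
  simp only [div_pow]
  field_simp
  ring

/-- Induction on M by integration by parts, a Taylor formula with remainder written through the
Euler derivative. The new density is W - (M+1)⁻¹ u W', which remains in the space. -/
lemma IsEulerSpace.exists_representation {𝓒 : Submodule ℝ (ℝ → ℝ)} (h𝓒 : IsEulerSpace n 𝓒)
    {F G : ℝ → ℝ} (hG : G ∈ 𝓒) (hFG : ∀ u, 0 < u → HasDerivAt F (G u / u) u)
    (hF : Tendsto F atTop (𝓝 0)) (M : ℕ) :
    ∃ W ∈ 𝓒, ∀ ρ, 0 < ρ → F ρ = ∫ u in Ioi ρ, (u - ρ) ^ M * (W u / u ^ (M + 1)) := by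
  induction M with
  | zero =>
    refine ⟨-G, 𝓒.neg_mem hG, fun ρ hρ => ?_⟩
    have := integral_Ioi_of_hasDerivAt_of_tendsto' (a := ρ)
      (fun u hu => hFG u (lt_of_lt_of_le hρ hu))
      ((h𝓒.int G hG).mono_set (Ioi_subset_Ioi hρ.le)) hF
    simp only [pow_zero, Pi.neg_apply, zero_add, pow_one, one_mul, neg_div]
    rw [integral_neg, this]
    ring
  | succ M ih =>
    obtain ⟨W, hW, hWF⟩ := ih
    obtain ⟨W₁, hW₁, hd⟩ := h𝓒.deriv W hW
    have hM : (M + 1 : ℝ) ≠ 0 := by positivity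
    refine ⟨W - (M + 1 : ℝ)⁻¹ • W₁, 𝓒.sub_mem hW (𝓒.smul_mem _ hW₁), fun ρ hρ => ?_⟩
    set W₂ := W - (M + 1 : ℝ)⁻¹ • W₁ with hW₂
    have hW₂m : W₂ ∈ 𝓒 := 𝓒.sub_mem hW (𝓒.smul_mem _ hW₁)
    rw [hWF ρ hρ]
    -- The function ((u - ρ)/u)^(M+1) W(u) vanishes at u = ρ and at infinity, so its derivative has
    -- integral 0. Writing ρ = u - (u - ρ) in this derivative separates the integrands of orders M
    -- and M + 1.
    have hder : ∀ u ∈ Ici ρ, HasDerivAt (fun u => (u - ρ) ^ (M + 1) * (W u / u ^ (M + 1)))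
        ((M + 1) * ((u - ρ) ^ M * (W u / u ^ (M + 1)) -
          (u - ρ) ^ (M + 1) * (W₂ u / u ^ (M + 1 + 1)))) u := by
      intro u hu
      have hu0 : 0 < u := lt_of_lt_of_le hρ hu
      have h1 : HasDerivAt (fun u => (u - ρ) ^ (M + 1)) (((M + 1 : ℕ) : ℝ) * (u - ρ) ^ M * 1) u :=
        ((hasDerivAt_id u).sub_const ρ).pow (M + 1)
      have h2 : HasDerivAt (fun u => W u / u ^ (M + 1)) _ u := (hd u hu0).div (hasDerivAt_pow (M + 1) u) (pow_ne_zero _ hu0.ne')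
      refine (h1.mul h2).congr_deriv ?_
      simp only [hW₂, Pi.sub_apply, Pi.smul_apply, smul_eq_mul, Nat.add_sub_cancel]
      push_cast
      field_simp
      ring
    have hi := ((h𝓒.integrableOn_pow hW hρ (M := M)).sub
      (h𝓒.integrableOn_pow hW₂m hρ (M := M + 1))).const_mul (M + 1 : ℝ)
    have hlim : Tendsto (fun u => (u - ρ) ^ (M + 1) * (W u / u ^ (M + 1))) atTop (𝓝 0) := by
      refine squeeze_zero_norm' ?_ (by simpa using (h𝓒.lim W hW).norm)
      filter_upwards [eventually_gt_atTop ρ] with u hu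
      have hu0 : 0 < u := hρ.trans hu
      rw [mul_div_left_comm, ← div_pow, norm_mul, norm_pow,
        Real.norm_of_nonneg (div_nonneg (by linarith) hu0.le)]
      refine mul_le_of_le_one_right (norm_nonneg _)
        (pow_le_one₀ (div_nonneg (by linarith) hu0.le) ?_)
      rw [div_le_one hu0]
      linarith
    have := integral_Ioi_of_hasDerivAt_of_tendsto' hder hi hlim
    rw [integral_const_mul, integral_sub (h𝓒.integrableOn_pow hW hρ)
      (h𝓒.integrableOn_pow hW₂m hρ)] at this
    simp only [sub_self, ne_eq, Nat.add_eq_zero_iff, one_ne_zero, and_false, not_false_eq_true,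
      zero_pow, zero_mul, mul_eq_zero, hM, false_or] at this
    linarith

/-- Order M = n + 2 of the representation at ρ = |ξ|²: (u - ρ)^M / u^M is the dilated Bochner–Riesz
symbol, which vanishes for u ≤ ρ. The origin is left out because F is controlled only on (0, ∞). -/
lemma IsEulerSpace.exists_superposition {𝓒 : Submodule ℝ (ℝ → ℝ)} (h𝓒 : IsEulerSpace n 𝓒)
    {F G : ℝ → ℝ} (hG : G ∈ 𝓒) (hFG : ∀ u, 0 < u → HasDerivAt F (G u / u) u)
    (hF : Tendsto F atTop (𝓝 0)) :
    ∃ W ∈ 𝓒, ∀ ξ : E n, ξ ≠ 0 →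
      (F (‖ξ‖ ^ 2) : ℂ) = ∫ u in Ioi 0, ((W u / u : ℝ) : ℂ) * brSymbol n ((√u)⁻¹ • ξ) := by
  obtain ⟨W, hW, h⟩ := h𝓒.exists_representation hG hFG hF (n + 2)
  refine ⟨W, hW, fun ξ hξ => ?_⟩
  have hρ : 0 < ‖ξ‖ ^ 2 := by positivity
  rw [h _ hρ, ← integral_complex_ofReal, ← integral_indicator measurableSet_Ioi,
    ← integral_indicator measurableSet_Ioi]
  congr 1 with u
  by_cases hu : 0 < u
  · rw [indicator_of_mem (show u ∈ Ioi 0 from hu), brSymbol, norm_smul, norm_inv,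
      Real.norm_of_nonneg (Real.sqrt_nonneg _), mul_pow, inv_pow, Real.sq_sqrt hu.le]
    by_cases hu2 : ‖ξ‖ ^ 2 < u
    · rw [indicator_of_mem (show u ∈ Ioi (‖ξ‖ ^ 2) from hu2), max_eq_left]
      · rw [← Complex.ofReal_mul]
        congr 1
        have : 1 - u⁻¹ * ‖ξ‖ ^ 2 = (u - ‖ξ‖ ^ 2) / u := by field_simp
        rw [this, div_pow]
        field_simp
        ring
      · rw [sub_nonneg, inv_mul_le_one₀ hu]
        exact hu2.le
    · rw [indicator_of_notMem (show u ∉ Ioi (‖ξ‖ ^ 2) from hu2), max_eq_right]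
      · simp
      · rw [sub_nonpos, one_le_inv_mul₀ hu]
        exact not_lt.1 hu2
  · rw [indicator_of_notMem (show u ∉ Ioi 0 from hu), indicator_of_notMem]
    simp only [mem_Ioi, not_lt] at hu ⊢
    exact hu.trans hρ.le

lemma ae_ne_zero (hn : 0 < n) : ∀ᵐ ξ : E n, ξ ≠ 0 := by
  have : Nonempty (Fin n) := ⟨⟨0, hn⟩⟩
  exact Measure.ae_ne volume 0

/-- Only the Euler derivative G must lie in the space, not F itself. This admits F with a nonzero
limit at 0, for which F(u)/u is not integrable there. -/
theorem IsEulerSpace.isGood_radial (hn : 0 < n) {𝓒 : Submodule ℝ (ℝ → ℝ)}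
    (h𝓒 : IsEulerSpace n 𝓒) {F G : ℝ → ℝ} (hG : G ∈ 𝓒)
    (hFG : ∀ u, 0 < u → HasDerivAt F (G u / u) u) (hF : Tendsto F atTop (𝓝 0)) {m : E n → ℂ}
    (hc : Continuous m) (hm : ∀ ξ, ξ ≠ 0 → m ξ = F (‖ξ‖ ^ 2)) : IsGood m := by
  obtain ⟨W, hW, h⟩ := h𝓒.exists_superposition hG hFG hF
  refine isGood_superposition (h𝓒.int W hW) (h𝓒.int_dim W hW) hc ?_
  filter_upwards [ae_ne_zero hn] with ξ hξ
  rw [hm ξ hξ, h ξ hξ]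

theorem IsEulerSpace.exists_integral_norm_sub_le (hn : 0 < n) {𝓒 : Submodule ℝ (ℝ → ℝ)}
    (h𝓒 : IsEulerSpace n 𝓒) (hs : ∀ F ∈ 𝓒, IntegrableOn (fun u => F u / u * √u) (Ioi 0))
    {F G : ℝ → ℝ} (hG : G ∈ 𝓒) (hFG : ∀ u, 0 < u → HasDerivAt F (G u / u) u)
    (hF : Tendsto F atTop (𝓝 0)) {m : E n → ℂ} (hm : ∀ ξ, ξ ≠ 0 → m ξ = F (‖ξ‖ ^ 2)) :
    ∃ C : ℝ, 0 ≤ C ∧ ∀ h : E n, ∫ x, ‖𝓕⁻ m (x + h) - 𝓕⁻ m x‖ ≤ C * ‖h‖ := by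
  obtain ⟨W, hW, h⟩ := h𝓒.exists_superposition hG hFG hF
  refine exists_integral_norm_sub_superposition_le (h𝓒.int W hW) (h𝓒.int_dim W hW) (hs W hW) ?_
  filter_upwards [ae_ne_zero hn] with ξ hξ
  rw [hm ξ hξ, h ξ hξ]

lemma sqrt_pow_eq_rpow {u : ℝ} (hu : 0 < u) (n : ℕ) : √u ^ n = u ^ ((n : ℝ) / 2) := by
  rw [Real.sqrt_eq_rpow, ← Real.rpow_natCast, ← Real.rpow_mul hu.le]
  congr 1
  ring

/-! ### The Euler space generated by `u ^ c * exp (-u ^ a)` -/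

/-- The span of the functions `u ^ c * exp (-u ^ a)` with `c ≥ c₀`. -/
def expSpace (a c₀ : ℝ) : Submodule ℝ (ℝ → ℝ) :=
  Submodule.span ℝ {φ | ∃ c, c₀ ≤ c ∧ φ = fun u => u ^ c * Real.exp (-u ^ a)}

lemma mem_expSpace {a c₀ c : ℝ} (hc : c₀ ≤ c) :
    (fun u : ℝ => u ^ c * Real.exp (-u ^ a)) ∈ expSpace a c₀ :=
  Submodule.subset_span ⟨c, hc, rfl⟩

lemma hasDerivAt_rpow_mul_exp (a c : ℝ) {u : ℝ} (hu : 0 < u) :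
    HasDerivAt (fun u : ℝ => u ^ c * Real.exp (-u ^ a))
      ((c * (u ^ c * Real.exp (-u ^ a)) - a * (u ^ (c + a) * Real.exp (-u ^ a))) / u) u := by
  have h1 := Real.hasDerivAt_rpow_const (x := u) (p := c) (Or.inl hu.ne')
  have h2 := (Real.hasDerivAt_rpow_const (x := u) (p := a) (Or.inl hu.ne')).fun_neg.exp
  refine (h1.mul h2).congr_deriv ?_
  rw [Real.rpow_sub_one hu.ne', Real.rpow_sub_one hu.ne', Real.rpow_add hu]
  field_simp
  ring

lemma tendsto_rpow_mul_exp {a : ℝ} (ha : 0 < a) (c : ℝ) :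
    Tendsto (fun u : ℝ => u ^ c * Real.exp (-u ^ a)) atTop (𝓝 0) := by
  have h := (tendsto_rpow_mul_exp_neg_mul_atTop_nhds_zero (c / a) 1 one_pos).comp
    (tendsto_rpow_atTop ha)
  refine h.congr' ?_
  filter_upwards [eventually_gt_atTop 0] with u hu
  simp only [Function.comp_apply]
  rw [← Real.rpow_mul hu.le, mul_div_cancel₀ _ ha.ne']
  simp

lemma integrableOn_expSpace {a c₀ : ℝ} (ha : 0 < a) {p : ℝ} (hp : -c₀ < p) {F : ℝ → ℝ}
    (hF : F ∈ expSpace a c₀) : IntegrableOn (fun u => F u / u * u ^ p) (Ioi 0) := by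
  induction hF using Submodule.span_induction with
  | mem φ h =>
    obtain ⟨c, hc, rfl⟩ := h
    refine (integrableOn_rpow_mul_exp_neg_rpow (p := a) (s := c - 1 + p) (by linarith) ha).congr_fun
      (fun u (hu : 0 < u) => ?_) measurableSet_Ioi
    simp only
    rw [Real.rpow_add hu, Real.rpow_sub_one hu.ne']
    ring
  | zero => simp
  | add φ ψ _ _ h₁ h₂ =>
    refine (h₁.add h₂).congr_fun (fun u _ => ?_) measurableSet_Ioi
    simp only [Pi.add_apply]
    ring
  | smul r φ _ h =>
    refine IntegrableOn.congr_fun (Integrable.const_mul h r) (fun u _ => ?_) measurableSet_Ioi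
    simp only [Pi.smul_apply, smul_eq_mul]
    ring

lemma exists_eulerDeriv_span {S : Set (ℝ → ℝ)}
    (hS : ∀ φ ∈ S, ∃ G ∈ Submodule.span ℝ S, ∀ u, 0 < u → HasDerivAt φ (G u / u) u)
    {F : ℝ → ℝ} (hF : F ∈ Submodule.span ℝ S) :
    ∃ G ∈ Submodule.span ℝ S, ∀ u, 0 < u → HasDerivAt F (G u / u) u := by
  induction hF using Submodule.span_induction with
  | mem φ h => exact hS φ h
  | zero => exact ⟨0, Submodule.zero_mem _, fun u _ => by simp⟩
  | add φ ψ _ _ h₁ h₂ =>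
    obtain ⟨G₁, hG₁, h₁⟩ := h₁
    obtain ⟨G₂, hG₂, h₂⟩ := h₂
    refine ⟨G₁ + G₂, Submodule.add_mem _ hG₁ hG₂, fun u hu => ?_⟩
    rw [Pi.add_apply, add_div]
    exact (h₁ u hu).add (h₂ u hu)
  | smul r φ _ h =>
    obtain ⟨G, hG, h⟩ := h
    refine ⟨r • G, Submodule.smul_mem _ r hG, fun u hu => ?_⟩
    rw [Pi.smul_apply, smul_eq_mul, mul_div_assoc]
    exact (h u hu).const_mul r

lemma tendsto_zero_span {S : Set (ℝ → ℝ)} (hS : ∀ φ ∈ S, Tendsto φ atTop (𝓝 0))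
    {F : ℝ → ℝ} (hF : F ∈ Submodule.span ℝ S) : Tendsto F atTop (𝓝 0) := by
  induction hF using Submodule.span_induction with
  | mem φ h => exact hS φ h
  | zero => exact tendsto_const_nhds
  | add φ ψ _ _ h₁ h₂ => rw [← add_zero (0 : ℝ)]; exact h₁.add h₂
  | smul r φ _ h => rw [← mul_zero r]; exact h.const_mul r

lemma isEulerSpace_expSpace (n : ℕ) {a c₀ : ℝ} (ha : 0 < a) (hc₀ : 0 < c₀) :
    IsEulerSpace n (expSpace a c₀) where
  deriv F hF := by
    refine exists_eulerDeriv_span ?_ hF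
    rintro φ ⟨c, hc, rfl⟩
    refine ⟨_, Submodule.sub_mem _ (Submodule.smul_mem _ c (mem_expSpace (a := a) hc))
      (Submodule.smul_mem _ a (mem_expSpace (a := a) (show c₀ ≤ c + a by linarith))), ?_⟩
    exact fun u hu => hasDerivAt_rpow_mul_exp a c hu
  lim F hF := by
    refine tendsto_zero_span ?_ hF
    rintro φ ⟨c, hc, rfl⟩
    exact tendsto_rpow_mul_exp ha c
  int F hF := by
    refine (integrableOn_expSpace ha (p := 0) (by linarith) hF).congr_fun (fun u _ => ?_)
      measurableSet_Ioi
    simp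
  int_dim F hF := by
    have : (0 : ℝ) ≤ n / 2 := by positivity
    refine (integrableOn_expSpace ha (p := n / 2) (by linarith) hF).congr_fun
      (fun u (hu : 0 < u) => ?_) measurableSet_Ioi
    simp only
    rw [sqrt_pow_eq_rpow hu]

/-- The symbol `‖ξ‖ ^ b * exp (-‖ξ‖ ^ a)`. -/
def expSymbol (n : ℕ) (b a : ℝ) (ξ : E n) : ℂ := ((‖ξ‖ ^ b * Real.exp (-‖ξ‖ ^ a) : ℝ) : ℂ)

lemma continuous_expSymbol {b a : ℝ} (hb : 0 ≤ b) (ha : 0 < a) :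
    Continuous (expSymbol n b a) := by
  refine Complex.continuous_ofReal.comp (Continuous.mul ?_ ?_)
  · exact continuous_norm.rpow_const fun _ => Or.inr hb
  · exact (continuous_norm.rpow_const fun _ => Or.inr ha.le).neg.rexp

lemma expSymbol_eq (b a : ℝ) (ξ : E n) :
    expSymbol n b a ξ =
      ((‖ξ‖ ^ 2) ^ (b / 2) * Real.exp (-(‖ξ‖ ^ 2) ^ (a / 2)) : ℝ) := by
  have h : ∀ c : ℝ, (‖ξ‖ ^ 2) ^ (c / 2) = ‖ξ‖ ^ c := by
    intro c
    rw [← Real.rpow_natCast ‖ξ‖ 2, ← Real.rpow_mul (norm_nonneg _)]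
    congr 1
    push_cast
    ring
  rw [h, h, expSymbol]

/-- For c = 0 the function exp(-u^a) tends to 1 at 0 and lies in no such space with c₀ > 0, but its
Euler derivative -a u^a exp(-u^a) does. This case covers the heat kernel itself. -/
lemma exists_eulerDeriv_mem_expSpace {a c : ℝ} (ha : 0 < a) (hc : 0 ≤ c) :
    ∃ c₀ > 0, ∃ G ∈ expSpace a c₀, ∀ u, 0 < u →
      HasDerivAt (fun u : ℝ => u ^ c * Real.exp (-u ^ a)) (G u / u) u := by
  rcases hc.eq_or_lt with rfl | hc
  · refine ⟨a, ha, _, Submodule.smul_mem _ (-a) (mem_expSpace le_rfl), fun u hu => ?_⟩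
    refine (hasDerivAt_rpow_mul_exp a 0 hu).congr_deriv ?_
    simp
  · exact ⟨c, hc, _, Submodule.sub_mem _ (Submodule.smul_mem _ c (mem_expSpace (a := a) le_rfl))
      (Submodule.smul_mem _ a (mem_expSpace (a := a) (show c ≤ c + a by linarith))),
      fun u hu => hasDerivAt_rpow_mul_exp a c hu⟩

lemma isGood_expSymbol (hn : 0 < n) {b a : ℝ} (hb : 0 ≤ b) (ha : 0 < a) :
    IsGood (expSymbol n b a) := by
  obtain ⟨c₀, hc₀, G, hG, h⟩ := exists_eulerDeriv_mem_expSpace (half_pos ha) (div_nonneg hb zero_le_two)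
  exact (isEulerSpace_expSpace n (half_pos ha) hc₀).isGood_radial hn hG h
    (tendsto_rpow_mul_exp (half_pos ha) _) (continuous_expSymbol hb ha)
    fun ξ _ => expSymbol_eq b a ξ

lemma exists_integral_norm_sub_expSymbol_le (hn : 0 < n) {b a : ℝ} (hb : 0 ≤ b) (ha : 0 < a) :
    ∃ C : ℝ, 0 ≤ C ∧ ∀ h : E n,
      ∫ x, ‖𝓕⁻ (expSymbol n b a) (x + h) - 𝓕⁻ (expSymbol n b a) x‖ ≤ C * ‖h‖ := by
  obtain ⟨c₀, hc₀, G, hG, h⟩ := exists_eulerDeriv_mem_expSpace (half_pos ha) (div_nonneg hb zero_le_two)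
  refine (isEulerSpace_expSpace n (half_pos ha) hc₀).exists_integral_norm_sub_le hn ?_ hG h
    (tendsto_rpow_mul_exp (half_pos ha) _) fun ξ _ => expSymbol_eq b a ξ
  intro F hF
  refine (integrableOn_expSpace (half_pos ha) (p := 1 / 2) (by linarith) hF).congr_fun
    (fun u _ => ?_) measurableSet_Ioi
  simp only
  rw [Real.sqrt_eq_rpow]

/-! ### The Euler space generated by `u ^ c * (1 + u) ^ (-l)` -/

/-- The span of the functions `u ^ c * (1 + u) ^ (-l)` with `c ≥ c₀` and `l ≥ c + d`. -/
def ratSpace (c₀ d : ℝ) : Submodule ℝ (ℝ → ℝ) :=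
  Submodule.span ℝ {φ | ∃ c l, c₀ ≤ c ∧ c + d ≤ l ∧ φ = fun u => u ^ c * (1 + u) ^ (-l)}

lemma mem_ratSpace {c₀ d c l : ℝ} (hc : c₀ ≤ c) (hl : c + d ≤ l) :
    (fun u : ℝ => u ^ c * (1 + u) ^ (-l)) ∈ ratSpace c₀ d :=
  Submodule.subset_span ⟨c, l, hc, hl, rfl⟩

lemma hasDerivAt_rpow_mul_one_add_rpow (c l : ℝ) {u : ℝ} (hu : 0 < u) :
    HasDerivAt (fun u : ℝ => u ^ c * (1 + u) ^ (-l))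
      ((c * (u ^ c * (1 + u) ^ (-l)) - l * (u ^ (c + 1) * (1 + u) ^ (-(l + 1)))) / u) u := by
  have h1 := Real.hasDerivAt_rpow_const (x := u) (p := c) (Or.inl hu.ne')
  have h2 := ((hasDerivAt_id u).const_add 1).rpow_const (p := -l) (Or.inl (by simp; positivity))
  refine (h1.mul h2).congr_deriv ?_
  have hu1 : (1 + u) ≠ 0 := by positivity
  simp only [id]
  rw [Real.rpow_sub_one hu.ne', Real.rpow_add_one hu.ne', show -(l + 1) = -l - 1 by ring,
    Real.rpow_sub_one hu1]
  field_simp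
  ring

lemma rpow_mul_one_add_rpow_le {c l u : ℝ} (hu : 0 < u) (hl : 0 ≤ l) :
    u ^ c * (1 + u) ^ (-l) ≤ u ^ (c - l) := by
  rw [sub_eq_add_neg, Real.rpow_add hu]
  refine mul_le_mul_of_nonneg_left ?_ (by positivity)
  exact Real.rpow_le_rpow_of_nonpos hu (le_add_of_nonneg_left zero_le_one)
    (neg_nonpos.2 hl)

lemma tendsto_rpow_mul_one_add_rpow {c l : ℝ} (hl : 0 ≤ l) (hcl : c < l) :
    Tendsto (fun u : ℝ => u ^ c * (1 + u) ^ (-l)) atTop (𝓝 0) := by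
  refine squeeze_zero' (g := fun u => u ^ (c - l)) ?_ ?_ ?_
  · filter_upwards [eventually_gt_atTop 0] with u hu
    positivity
  · filter_upwards [eventually_gt_atTop 0] with u hu
    exact rpow_mul_one_add_rpow_le hu hl
  · have := tendsto_rpow_neg_atTop (show 0 < l - c by linarith)
    simpa using this

lemma integrableOn_rpow_mul_one_add_rpow {c l : ℝ} (hl : 0 ≤ l) (hc : -1 < c) (hcl : c - l < -1) :
    IntegrableOn (fun u : ℝ => u ^ c * (1 + u) ^ (-l)) (Ioi 0) := by
  have hm : Measurable fun u : ℝ => u ^ c * (1 + u) ^ (-l) := by fun_prop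
  rw [← Ioc_union_Ioi_eq_Ioi (zero_le_one (α := ℝ))]
  refine IntegrableOn.union ?_ ?_
  · have h1 : IntegrableOn (fun u : ℝ => u ^ c) (Ioc 0 1) :=
      (intervalIntegral.intervalIntegrable_rpow' hc (a := 0) (b := 1)).1
    refine h1.mono' hm.aestronglyMeasurable ?_
    filter_upwards [ae_restrict_mem measurableSet_Ioc] with u hu
    have := hu.1
    rw [Real.norm_of_nonneg (by positivity)]
    refine mul_le_of_le_one_right (by positivity) ?_
    exact Real.rpow_le_one_of_one_le_of_nonpos (by linarith) (by linarith)
  · refine (integrableOn_Ioi_rpow_of_lt hcl one_pos).mono' hm.aestronglyMeasurable ?_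
    filter_upwards [ae_restrict_mem measurableSet_Ioi] with u (hu : 1 < u)
    rw [Real.norm_of_nonneg (by positivity)]
    exact rpow_mul_one_add_rpow_le (by linarith) hl

/-- The condition -c₀ < p is integrability at 0, and p < d is integrability at infinity. -/
lemma integrableOn_ratSpace {c₀ d : ℝ} (hc₀ : 0 < c₀) (hd : 0 < d) {p : ℝ} (hp : -c₀ < p)
    (hpd : p < d) {F : ℝ → ℝ} (hF : F ∈ ratSpace c₀ d) :
    IntegrableOn (fun u => F u / u * u ^ p) (Ioi 0) := by
  induction hF using Submodule.span_induction with
  | mem φ h =>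
    obtain ⟨c, l, hc, hl, rfl⟩ := h
    refine (integrableOn_rpow_mul_one_add_rpow (c := c - 1 + p) (l := l) (by linarith)
      (by linarith) (by linarith)).congr_fun (fun u (hu : 0 < u) => ?_) measurableSet_Ioi
    simp only
    rw [Real.rpow_add hu, Real.rpow_sub_one hu.ne']
    ring
  | zero => simp
  | add φ ψ _ _ h₁ h₂ =>
    refine (h₁.add h₂).congr_fun (fun u _ => ?_) measurableSet_Ioi
    simp only [Pi.add_apply]
    ring
  | smul r φ _ h =>
    refine IntegrableOn.congr_fun (Integrable.const_mul h r) (fun u _ => ?_) measurableSet_Ioi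
    simp only [Pi.smul_apply, smul_eq_mul]
    ring

lemma isEulerSpace_ratSpace {n : ℕ} {c₀ d : ℝ} (hc₀ : 0 < c₀) (hd : (n : ℝ) / 2 < d) :
    IsEulerSpace n (ratSpace c₀ d) where
  deriv F hF := by
    refine exists_eulerDeriv_span ?_ hF
    rintro φ ⟨c, l, hc, hl, rfl⟩
    refine ⟨_, Submodule.sub_mem _ (Submodule.smul_mem _ c (mem_ratSpace hc hl))
      (Submodule.smul_mem _ l (mem_ratSpace (show c₀ ≤ c + 1 by linarith)
        (show c + 1 + d ≤ l + 1 by linarith))), ?_⟩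
    exact fun u hu => hasDerivAt_rpow_mul_one_add_rpow c l hu
  lim F hF := by
    have : (0 : ℝ) ≤ n / 2 := by positivity
    refine tendsto_zero_span ?_ hF
    rintro φ ⟨c, l, hc, hl, rfl⟩
    exact tendsto_rpow_mul_one_add_rpow (by linarith) (by linarith)
  int F hF := by
    have : (0 : ℝ) ≤ n / 2 := by positivity
    refine (integrableOn_ratSpace hc₀ (by linarith) (p := 0) (by linarith) (by linarith)
      hF).congr_fun (fun u _ => ?_) measurableSet_Ioi
    simp
  int_dim F hF := by
    have : (0 : ℝ) ≤ n / 2 := by positivity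
    refine (integrableOn_ratSpace hc₀ (by linarith) (p := n / 2) (by linarith) hd hF).congr_fun
      (fun u (hu : 0 < u) => ?_) measurableSet_Ioi
    simp only
    rw [sqrt_pow_eq_rpow hu]

lemma isGood_rpow_mul_one_add_pow (hn : 0 < n) {β : ℝ} (hβ : 0 < β) {L : ℕ}
    (hL : β / 2 + n / 2 < L) :
    IsGood (fun ξ : E n => ((‖ξ‖ ^ β * ((1 + ‖ξ‖ ^ 2) ^ L)⁻¹ : ℝ) : ℂ)) := by
  have hβ2 := half_pos hβ
  have h𝓒 := isEulerSpace_ratSpace (n := n) hβ2 (show (n : ℝ) / 2 < L - β / 2 by linarith)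
  have hmem := mem_ratSpace (le_refl (β / 2)) (show β / 2 + (L - β / 2) ≤ (L : ℝ) by linarith)
  obtain ⟨G, hG, h⟩ := h𝓒.deriv _ hmem
  refine h𝓒.isGood_radial hn hG h (h𝓒.lim _ hmem) ?_ fun ξ _ => ?_
  · refine Complex.continuous_ofReal.comp (Continuous.mul ?_ (Continuous.inv₀ (by fun_prop) ?_))
    · exact continuous_norm.rpow_const fun _ => Or.inr hβ.le
    · intro ξ
      positivity
  · rw [Real.rpow_neg (by positivity), Real.rpow_natCast, ← Real.rpow_natCast ‖ξ‖ 2,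
      ← Real.rpow_mul (norm_nonneg _)]
    congr 3
    push_cast
    ring_nf

lemma isGood_schwartz (ψ : 𝓢(E n, ℂ)) : IsGood (ψ : E n → ℂ) where
  cont := ψ.continuous
  int := ψ.integrable
  inv := by
    rw [← SchwartzMap.fourierInv_coe]
    exact (𝓕⁻ ψ).integrable

/-- Write |ξ|^β ψ as |ξ|^β (1 + |ξ|²)^{-L} times the Schwartz function (1 + |ξ|²)^L ψ; for L large
the first factor falls under the radial criterion. -/
lemma isGood_rpow_mul_schwartz (hn : 0 < n) {β : ℝ} (hβ : 0 < β) (ψ : 𝓢(E n, ℂ)) :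
    IsGood (fun ξ : E n => (((2 * Real.pi * ‖ξ‖) ^ β : ℝ) : ℂ) * ψ ξ) := by
  obtain ⟨L, hL⟩ := exists_nat_gt (β / 2 + (n : ℝ) / 2)
  have ht : Function.HasTemperateGrowth (fun ξ : E n => (((1 + ‖ξ‖ ^ 2) ^ L : ℝ) : ℂ)) := by
    fun_prop
  have h := ((isGood_rpow_mul_one_add_pow hn hβ hL).mul
    (isGood_schwartz (SchwartzMap.smulLeftCLM ℂ
      (fun ξ : E n => (((1 + ‖ξ‖ ^ 2) ^ L : ℝ) : ℂ)) ψ))).const_mul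
    (((2 * Real.pi) ^ β : ℝ) : ℂ)
  convert h using 2 with ξ
  rw [SchwartzMap.smulLeftCLM_apply_apply ht, Real.mul_rpow (by positivity) (norm_nonneg _),
    smul_eq_mul]
  have h0 : (((1 + ‖ξ‖ ^ 2) ^ L : ℝ) : ℂ) ≠ 0 := by
    exact_mod_cast (show (1 + ‖ξ‖ ^ 2) ^ L ≠ 0 by positivity)
  push_cast at h0 ⊢
  field_simp

/-! ### The heat symbols -/

/-- The symbol `|2πξ|^b exp (-t |2πξ|^α)`. -/
def heatSymbol (n : ℕ) (b α t : ℝ) (ξ : E n) : ℂ :=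
  (((2 * Real.pi * ‖ξ‖) ^ b * Real.exp (-t * (2 * Real.pi * ‖ξ‖) ^ α) : ℝ) : ℂ)

/-- The dilation factor relating `heatSymbol` to `expSymbol`. -/
def heatScale (α t : ℝ) : ℝ := 2 * Real.pi * t ^ α⁻¹

lemma heatScale_pos (α : ℝ) {t : ℝ} (ht : 0 < t) : 0 < heatScale α t := by
  have := Real.pi_pos
  unfold heatScale
  positivity

/-- Homogeneity puts all dependence on t into the factor t^{-b/α} and a dilation. -/
lemma heatSymbol_eq_dilate (b : ℝ) {α t : ℝ} (hα : α ≠ 0) (ht : 0 < t) :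
    heatSymbol n b α t =
      fun ξ => ((t ^ (-(b / α)) : ℝ) : ℂ) * expSymbol n b α (heatScale α t • ξ) := by
  ext ξ
  have hπ := Real.pi_pos
  rw [heatSymbol, expSymbol, ← Complex.ofReal_mul, norm_smul,
    Real.norm_of_nonneg (heatScale_pos α ht).le, heatScale]
  have e : 2 * Real.pi * t ^ α⁻¹ * ‖ξ‖ = t ^ α⁻¹ * (2 * Real.pi * ‖ξ‖) := by ring
  have h1 : (t ^ α⁻¹) ^ α = t := by rw [← Real.rpow_mul ht.le, inv_mul_cancel₀ hα, Real.rpow_one]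
  have h2 : t ^ (-(b / α)) * (t ^ α⁻¹) ^ b = 1 := by
    rw [← Real.rpow_mul ht.le, ← Real.rpow_add ht]
    rw [show -(b / α) + α⁻¹ * b = 0 by ring, Real.rpow_zero]
  have h3 : ∀ c : ℝ, (t ^ α⁻¹ * (2 * Real.pi * ‖ξ‖)) ^ c =
      (t ^ α⁻¹) ^ c * (2 * Real.pi * ‖ξ‖) ^ c :=
    fun c => Real.mul_rpow (by positivity) (by positivity)
  rw [e, h3, h3, h1, ← mul_assoc, ← mul_assoc, h2, one_mul,
    neg_mul]

lemma isGood_heatSymbol (hn : 0 < n) {b α t : ℝ} (hb : 0 ≤ b) (hα : 0 < α) (ht : 0 < t) :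
    IsGood (heatSymbol n b α t) := by
  rw [heatSymbol_eq_dilate b hα.ne' ht]
  exact ((isGood_expSymbol hn hb hα).dilate (heatScale_pos α ht).ne').const_mul _

lemma op_heatSymbol (hn : 0 < n) {b α t : ℝ} (hb : 0 ≤ b) (hα : 0 < α) (ht : 0 < t)
    (f : E n →ᵇ ℂ) : op (heatSymbol n b α t) f =
      ((t ^ (-(b / α)) : ℝ) : ℂ) • op (fun ξ => expSymbol n b α (heatScale α t • ξ)) f := by
  rw [heatSymbol_eq_dilate b hα.ne' ht,
    op_const_mul _ ((isGood_expSymbol hn hb hα).dilate (heatScale_pos α ht).ne')]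

/-- The `L¹` norm of the kernel of `expSymbol`. -/
def expNorm (n : ℕ) (b α : ℝ) : ℝ := ∫ y : E n, ‖𝓕⁻ (expSymbol n b α) y‖

lemma expNorm_nonneg (n : ℕ) (b α : ℝ) : 0 ≤ expNorm n b α :=
  integral_nonneg fun _ => norm_nonneg _

lemma norm_op_heatSymbol_le (hn : 0 < n) {b α t : ℝ} (hb : 0 ≤ b) (hα : 0 < α) (ht : 0 < t)
    (f : E n →ᵇ ℂ) :
    ‖op (heatSymbol n b α t) f‖ ≤ expNorm n b α * t ^ (-(b / α)) * ‖f‖ := by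
  rw [op_heatSymbol hn hb hα ht, norm_smul, Complex.norm_real,
    Real.norm_of_nonneg (Real.rpow_nonneg ht.le _)]
  have := (isGood_expSymbol hn hb hα).norm_op_dilate_le (heatScale_pos α ht).ne' f
  calc _ ≤ t ^ (-(b / α)) * (expNorm n b α * ‖f‖) := by gcongr; exact this
    _ = _ := by ring

lemma integral_norm_fourierInv_heatSymbol {b α t : ℝ} (hα : 0 < α) (ht : 0 < t) :
    ∫ y, ‖𝓕⁻ (heatSymbol n b α t) y‖ = expNorm n b α * t ^ (-(b / α)) := by
  rw [heatSymbol_eq_dilate b hα.ne' ht, fourierInv_const_mul]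
  simp only [norm_mul, Complex.norm_real, Real.norm_of_nonneg (Real.rpow_nonneg ht.le _)]
  rw [integral_const_mul, integral_norm_fourierInv_dilate _ (heatScale_pos α ht).ne', mul_comm,
    expNorm]

lemma heatSymbol_mul {b b' α t t' : ℝ} (hb : 0 ≤ b) (hb' : 0 ≤ b') :
    (fun ξ => heatSymbol n b α t ξ * heatSymbol n b' α t' ξ) =
      heatSymbol n (b + b') α (t + t') := by
  have hπ := Real.pi_pos
  ext ξ
  rw [heatSymbol, heatSymbol, heatSymbol, ← Complex.ofReal_mul,
    Real.rpow_add_of_nonneg (by positivity) hb hb',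
    show -(t + t') * (2 * Real.pi * ‖ξ‖) ^ α = -t * (2 * Real.pi * ‖ξ‖) ^ α +
      -t' * (2 * Real.pi * ‖ξ‖) ^ α by ring, Real.exp_add]
  congr 1
  ring

lemma op_heatSymbol_add (hn : 0 < n) {b b' α t t' : ℝ} (hb : 0 ≤ b) (hb' : 0 ≤ b') (hα : 0 < α)
    (ht : 0 < t) (ht' : 0 < t') (f : E n →ᵇ ℂ) :
    op (heatSymbol n (b + b') α (t + t')) f =
      op (heatSymbol n b α t) (op (heatSymbol n b' α t') f) := by
  rw [← heatSymbol_mul hb hb', op_mul (isGood_heatSymbol hn hb hα ht)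
    (isGood_heatSymbol hn hb' hα ht')]

/-! ### Bounded continuous functions -/

/-- The complex bounded continuous function given by a bounded continuous real function. -/
def toBCF (f : E n → ℝ) (hf : Continuous f) {M : ℝ} (hM : ∀ x, |f x| ≤ M) : E n →ᵇ ℂ :=
  BoundedContinuousFunction.ofNormedAddCommGroup (fun x => (f x : ℂ))
    (Complex.continuous_ofReal.comp hf) M (fun x => by simpa using hM x)

lemma toBCF_apply (f : E n → ℝ) (hf : Continuous f) {M : ℝ} (hM : ∀ x, |f x| ≤ M) (x : E n) :
    toBCF f hf hM x = f x := rfl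

lemma heat_eq_op (hn : 0 < n) {α t : ℝ} (hα : 0 < α) (ht : 0 < t) (f : E n → ℝ)
    (hf : Continuous f) {M : ℝ} (hM : ∀ x, |f x| ≤ M) :
    heat α t f = op (heatSymbol n 0 α t) (toBCF f hf hM) := by
  ext x
  rw [op, conv_apply' (isGood_heatSymbol hn le_rfl hα ht).inv, heat]
  congr! with z
  rw [heatKernel]
  congr 1
  ext ξ
  simp [heatSymbol]

lemma forall_norm_le_of_ae {F : Type*} [NormedAddCommGroup F] {f : E n → F} (hf : Continuous f)
    {c : ℝ} (h : ∀ᵐ x, ‖f x‖ ≤ c) (x : E n) : ‖f x‖ ≤ c := by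
  have hd := Measure.dense_of_ae h
  have hc : IsClosed {x | ‖f x‖ ≤ c} := isClosed_le hf.norm continuous_const
  have := hd.closure_eq
  rw [hc.closure_eq] at this
  exact this.symm.subset (mem_univ x)

lemma norm_le_of_memLp_top {F : Type*} [NormedAddCommGroup F] {f : E n → F} (hf : Continuous f)
    (h : MemLp f ∞ volume) (x : E n) : ‖f x‖ ≤ (eLpNorm f ∞ volume).toReal := by
  refine forall_norm_le_of_ae hf ?_ x
  filter_upwards [ae_le_eLpNormEssSup (f := f) (μ := volume)] with y hy
  rw [← eLpNorm_exponent_top] at hy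
  have := ENNReal.toReal_mono h.eLpNorm_ne_top hy
  simpa using this

lemma memLp_bcf (f : E n →ᵇ ℂ) : MemLp f ∞ volume :=
  memLp_top_of_bound f.continuous.aestronglyMeasurable ‖f‖
    (Eventually.of_forall f.norm_coe_le_norm)

lemma eLpNorm_bcf (f : E n →ᵇ ℂ) : eLpNorm f ∞ volume = ENNReal.ofReal ‖f‖ := by
  apply le_antisymm
  · rw [eLpNorm_exponent_top]
    exact eLpNormEssSup_le_of_ae_bound (Eventually.of_forall f.norm_coe_le_norm)
  · rw [ENNReal.ofReal_le_iff_le_toReal (memLp_bcf f).eLpNorm_ne_top]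
    exact (BoundedContinuousFunction.norm_le ENNReal.toReal_nonneg).2
      (norm_le_of_memLp_top f.continuous (memLp_bcf f))

/-! ### The distributional fractional Laplacian -/

lemma IsGood.integrable_fourier {m : E n → ℂ} (hm : IsGood m) : Integrable (𝓕 m) := by
  refine hm.inv.comp_neg.congr (Eventually.of_forall fun x => ?_)
  simp [Real.fourierInv_eq_fourier_neg]

/-- Transposition: convolution by the kernel of m passes to multiplication by m on the test side.
Fubini applies because f is bounded and both kernels are integrable, so f itself is never Fourier
transformed. -/
lemma integral_op_mul_fourier {m χ : E n → ℂ} (hm : IsGood m) (hχ : IsGood χ) (f : E n →ᵇ ℂ) :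
    ∫ x, op m f x * 𝓕 χ x = ∫ z, f z * 𝓕 (fun ξ => m ξ * χ ξ) z := by
  have e1 : ∀ x, op m f x * 𝓕 χ x = ∫ z, 𝓕 χ x * 𝓕⁻ m (x - z) * f z := by
    intro x
    rw [op, conv_apply' hm.inv, ← integral_mul_const]
    congr 1 with z
    ring
  simp_rw [e1]
  rw [integral_integral_swap]
  · congr 1 with z
    rw [integral_mul_const, mul_comm]
    congr 1
    have h1 : 𝓕 (fun ξ => m ξ * χ ξ) z = 𝓕⁻ (fun ξ => m ξ * χ ξ) (-z) := by
      rw [Real.fourierInv_eq_fourier_neg, neg_neg]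
    rw [h1, fourierInv_mul hm hχ]
    conv_rhs => rw [← integral_sub_right_eq_self _ z]
    congr 1 with y
    rw [Real.fourierInv_eq_fourier_neg χ, mul_comm, show -(-z - (y - z)) = y by abel]
  · have h3 : Integrable (fun p : E n × E n => 𝓕 χ p.1 * 𝓕⁻ m (p.1 - p.2))
        (volume.prod volume) := by
      have := (hχ.integrable_fourier.convolution_integrand (ContinuousLinearMap.mul ℂ ℂ)
        hm.inv.comp_neg).swap
      refine this.congr (Eventually.of_forall fun p => ?_)
      simp
    refine h3.mul_bdd (c := ‖f‖) ?_ (Eventually.of_forall fun p => f.norm_coe_le_norm _)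
    exact (f.continuous.comp (by fun_prop)).aestronglyMeasurable

lemma isFracLaplacian_op_heatSymbol (hn : 0 < n) {β α t : ℝ} (hβ : 0 < β) (hα : 0 < α)
    (ht : 0 < t) (f : E n →ᵇ ℂ) :
    IsFracLaplacian β (op (heatSymbol n 0 α t) f) (op (heatSymbol n β α t) f) := by
  intro ψ
  rw [integral_op_mul_fourier (isGood_heatSymbol hn hβ.le hα ht) (isGood_schwartz ψ),
    integral_op_mul_fourier (isGood_heatSymbol hn le_rfl hα ht) (isGood_rpow_mul_schwartz hn hβ ψ)]
  have : (fun ξ => heatSymbol n β α t ξ * ψ ξ) = fun ξ : E n => heatSymbol n 0 α t ξ *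
      ((((2 * Real.pi * ‖ξ‖) ^ β : ℝ) : ℂ) * ψ ξ) := by
    ext ξ
    simp only [heatSymbol, Real.rpow_zero]
    push_cast
    ring
  rw [this]

/-- Every smooth compactly supported function is the Fourier transform of a Schwartz function, so
the pairings determine the function almost everywhere. -/
lemma ae_eq_of_integral_mul_fourier_eq {g₁ g₂ : E n → ℂ} (h₁ : MemLp g₁ ∞ volume)
    (h₂ : MemLp g₂ ∞ volume)
    (h : ∀ ψ : 𝓢(E n, ℂ), ∫ x, g₁ x * 𝓕 (fun ξ => ψ ξ) x = ∫ x, g₂ x * 𝓕 (fun ξ => ψ ξ) x) :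
    g₁ =ᵐ[volume] g₂ := by
  refine ae_eq_of_integral_contDiff_smul_eq (h₁.locallyIntegrable le_top)
    (h₂.locallyIntegrable le_top) fun g hg hgc => ?_
  have hg₁ : HasCompactSupport (Complex.ofRealCLM ∘ g) := hgc.comp_left rfl
  have hg₂ : ContDiff ℝ _ (Complex.ofRealCLM ∘ g) := Complex.ofRealCLM.contDiff.comp hg
  have := h (𝓕⁻ (hg₁.toSchwartzMap hg₂))
  have e : 𝓕 (fun ξ => 𝓕⁻ (hg₁.toSchwartzMap hg₂) ξ) = fun x => (g x : ℂ) := by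
    have h2 : 𝓕 (𝓕⁻ (hg₁.toSchwartzMap hg₂)) = hg₁.toSchwartzMap hg₂ :=
      FourierTransform.fourier_fourierInv_eq _
    have h3 := SchwartzMap.fourier_coe (𝓕⁻ (hg₁.toSchwartzMap hg₂))
    rw [h2] at h3
    exact h3.symm
  rw [e] at this
  simpa [Complex.real_smul, mul_comm] using this

/-- The convolution with symbol |2πξ|^β exp(-t|2πξ|^α) is one representative, and by uniqueness
every competitor in the infimum agrees with it almost everywhere. -/
theorem fracLaplacianNorm_heat (hn : 0 < n) {β α t : ℝ} (hβ : 0 < β) (hα : 0 < α)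
    (ht : 0 < t) (f : E n → ℝ) (hf : Continuous f) {M : ℝ} (hM : ∀ x, |f x| ≤ M) :
    fracLaplacianNorm β (heat α t f) =
      ENNReal.ofReal ‖op (heatSymbol n β α t) (toBCF f hf hM)‖ := by
  rw [heat_eq_op hn hα ht f hf hM, ← eLpNorm_bcf]
  have hL := isFracLaplacian_op_heatSymbol hn hβ hα ht (toBCF f hf hM)
  apply le_antisymm
  · exact iInf_le_of_le _ (iInf₂_le_of_le (memLp_bcf _) hL le_rfl)
  · refine le_iInf fun h => le_iInf₂ fun hh hhL => ?_
    have : h =ᵐ[volume] op (heatSymbol n β α t) (toBCF f hf hM) :=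
      ae_eq_of_integral_mul_fourier_eq hh (memLp_bcf _) fun ψ => by rw [hhL ψ, hL ψ]
    rw [eLpNorm_congr_ae this]

/-! ### Differences of bounded continuous functions -/

/-- Translation of a bounded continuous function. -/
def shift (c : E n) (f : E n →ᵇ ℂ) : E n →ᵇ ℂ :=
  f.compContinuous ⟨fun x => x + c, by fun_prop⟩

lemma shift_apply (c : E n) (f : E n →ᵇ ℂ) (x : E n) : shift c f x = f (x + c) := rfl

/-- The symmetric difference operator on bounded continuous functions. -/
def bdiff (h : E n) : Module.End ℂ (E n →ᵇ ℂ) where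
  toFun f := shift ((2⁻¹ : ℝ) • h) f - shift (-((2⁻¹ : ℝ) • h)) f
  map_add' f g := by
    ext x
    simp only [BoundedContinuousFunction.sub_apply, BoundedContinuousFunction.add_apply,
      shift_apply]
    ring
  map_smul' c f := by
    ext x
    simp only [BoundedContinuousFunction.sub_apply, BoundedContinuousFunction.smul_apply,
      shift_apply, smul_eq_mul, RingHom.id_apply]
    ring

lemma bdiff_apply (h : E n) (f : E n →ᵇ ℂ) (x : E n) :
    bdiff h f x = f (x + (2⁻¹ : ℝ) • h) - f (x - (2⁻¹ : ℝ) • h) := by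
  rw [sub_eq_add_neg x]
  rfl

lemma bdiff_pow_apply (h : E n) (k : ℕ) (F : E n →ᵇ ℂ) (f : E n → ℝ) (hF : ∀ x, F x = f x)
    (x : E n) : (bdiff h ^ k) F x = iterDiff k h f x := by
  induction k generalizing F f with
  | zero => simpa [iterDiff] using hF x
  | succ k ih =>
    rw [pow_succ, Module.End.mul_apply, ih (bdiff h F) (diff h f), iterDiff, iterDiff,
      Function.iterate_succ_apply]
    intro y
    rw [bdiff_apply, hF, hF, diff]
    push_cast
    rfl

lemma norm_bdiff_le (h : E n) (f : E n →ᵇ ℂ) : ‖bdiff h f‖ ≤ 2 * ‖f‖ := by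
  refine (BoundedContinuousFunction.norm_le (by positivity)).2 fun x => ?_
  rw [bdiff_apply]
  refine (norm_sub_le _ _).trans ?_
  linarith [f.norm_coe_le_norm (x + (2⁻¹ : ℝ) • h), f.norm_coe_le_norm (x - (2⁻¹ : ℝ) • h)]

lemma norm_bdiff_pow_le (h : E n) (k : ℕ) (f : E n →ᵇ ℂ) :
    ‖(bdiff h ^ k) f‖ ≤ 2 ^ k * ‖f‖ := by
  induction k with
  | zero => simp
  | succ k ih =>
    rw [pow_succ', Module.End.mul_apply]
    refine (norm_bdiff_le _ _).trans ?_
    rw [pow_succ']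
    linarith

lemma bdiff_zero : bdiff (0 : E n) = 0 := by
  ext f x
  simp [bdiff_apply]

lemma bdiff_op {m : E n → ℂ} (hm : IsGood m) (h : E n) (f : E n →ᵇ ℂ) :
    bdiff h (op m f) = op m (bdiff h f) := by
  ext x
  rw [bdiff_apply, op, op, conv_apply hm.inv, conv_apply hm.inv, conv_apply hm.inv,
    ← integral_sub (integrable_kernel_mul hm.inv f _) (integrable_kernel_mul hm.inv f _)]
  congr 1 with y
  rw [bdiff_apply, mul_sub, add_sub_right_comm, sub_right_comm]

lemma bdiff_pow_op {m : E n → ℂ} (hm : IsGood m) (h : E n) (k : ℕ) (f : E n →ᵇ ℂ) :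
    (bdiff h ^ k) (op m f) = op m ((bdiff h ^ k) f) := by
  induction k with
  | zero => simp
  | succ k ih => rw [pow_succ', Module.End.mul_apply, Module.End.mul_apply, ih, bdiff_op hm]

lemma norm_bdiff_op_le {m : E n → ℂ} (hm : IsGood m) (h : E n) (f : E n →ᵇ ℂ) :
    ‖bdiff h (op m f)‖ ≤ (∫ y, ‖𝓕⁻ m (y + h) - 𝓕⁻ m y‖) * ‖f‖ := by
  refine (BoundedContinuousFunction.norm_le (by positivity)).2 fun x => ?_
  have hi : ∀ c : E n, Integrable fun z => 𝓕⁻ m (c - z) * f z := by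
    intro c
    refine (hm.inv.comp_sub_left c).mul_bdd (c := ‖f‖) f.continuous.aestronglyMeasurable
      (Eventually.of_forall f.norm_coe_le_norm)
  rw [bdiff_apply, op, conv_apply' hm.inv, conv_apply' hm.inv, ← integral_sub (hi _) (hi _)]
  refine (norm_integral_le_integral_norm _).trans ?_
  have hg : Integrable fun w => ‖𝓕⁻ m (w + h) - 𝓕⁻ m w‖ :=
    ((hm.inv.comp_add_right h).sub hm.inv).norm
  set c := x - (2⁻¹ : ℝ) • h with hc
  have hg' : Integrable fun z => ‖𝓕⁻ m (c - z + h) - 𝓕⁻ m (c - z)‖ := hg.comp_sub_left c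
  have e : ∫ w, ‖𝓕⁻ m (w + h) - 𝓕⁻ m w‖ = ∫ z, ‖𝓕⁻ m (c - z + h) - 𝓕⁻ m (c - z)‖ :=
    (integral_sub_left_eq_self (fun w => ‖𝓕⁻ m (w + h) - 𝓕⁻ m w‖) volume c).symm
  rw [e, ← integral_mul_const]
  refine integral_mono ((hi _).sub (hi _)).norm (hg'.mul_const _) fun z => ?_
  simp only
  rw [← sub_mul, norm_mul, show x + (2⁻¹ : ℝ) • h - z = c - z + h by rw [hc]; module]
  exact mul_le_mul_of_nonneg_left (f.norm_coe_le_norm z) (norm_nonneg _)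

/-- One difference costs |h| t^{-1/α} by the L¹ Lipschitz bound for the kernel. Higher orders follow
by splitting e^{-tA} into two halves, with one difference on one half and k on the other; halving
the time produces the powers of 2^(α⁻¹). -/
lemma exists_norm_bdiff_pow_heat_le (hn : 0 < n) {α : ℝ} (hα : 0 < α) (k : ℕ) :
    ∃ C : ℝ, 0 ≤ C ∧ ∀ (t : ℝ), 0 < t → ∀ (h : E n) (f : E n →ᵇ ℂ),
      ‖(bdiff h ^ k) (op (heatSymbol n 0 α t) f)‖ ≤ C * (‖h‖ * t ^ (-α⁻¹)) ^ k * ‖f‖ := by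
  obtain ⟨C₁, hC₁, hC₁'⟩ := exists_integral_norm_sub_expSymbol_le hn le_rfl hα
  have hπ := Real.pi_pos
  have h1 : ∀ (t : ℝ), 0 < t → ∀ (h : E n) (f : E n →ᵇ ℂ),
      ‖bdiff h (op (heatSymbol n 0 α t) f)‖ ≤
        C₁ * (2 * Real.pi)⁻¹ * (‖h‖ * t ^ (-α⁻¹)) * ‖f‖ := by
    intro t ht h f
    rw [op_heatSymbol hn le_rfl hα ht]
    simp only [zero_div, neg_zero, Real.rpow_zero, Complex.ofReal_one, one_smul]
    refine (norm_bdiff_op_le ((isGood_expSymbol hn le_rfl hα).dilate (heatScale_pos α ht).ne')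
      h f).trans ?_
    gcongr
    rw [integral_norm_fourierInv_dilate_sub _ (heatScale_pos α ht).ne']
    refine (hC₁' _).trans (le_of_eq ?_)
    rw [norm_smul, norm_inv, Real.norm_of_nonneg (heatScale_pos α ht).le, heatScale,
      Real.rpow_neg ht.le, mul_inv]
    ring
  induction k with
  | zero =>
    refine ⟨expNorm n 0 α, expNorm_nonneg _ _ _, fun t ht h f => ?_⟩
    simpa using norm_op_heatSymbol_le hn le_rfl hα ht f
  | succ k ih =>
    obtain ⟨C, hC, hC'⟩ := ih
    refine ⟨C * (2 ^ α⁻¹) ^ (k + 1) * (C₁ * (2 * Real.pi)⁻¹), by positivity, fun t ht h f => ?_⟩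
    have ht2 : 0 < t / 2 := half_pos ht
    have e : op (heatSymbol n 0 α t) f =
        op (heatSymbol n 0 α (t / 2)) (op (heatSymbol n 0 α (t / 2)) f) := by
      rw [← op_heatSymbol_add hn le_rfl le_rfl hα ht2 ht2, add_zero, add_halves]
    have e2 : (t / 2) ^ (-α⁻¹) = 2 ^ α⁻¹ * t ^ (-α⁻¹) := by
      rw [Real.div_rpow ht.le zero_le_two, Real.rpow_neg zero_le_two, div_inv_eq_mul, mul_comm]
    rw [pow_succ, Module.End.mul_apply, e, bdiff_op (isGood_heatSymbol hn le_rfl hα ht2)]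
    calc _ ≤ C * (‖h‖ * (t / 2) ^ (-α⁻¹)) ^ k * ‖bdiff h (op (heatSymbol n 0 α (t / 2)) f)‖ :=
          hC' _ ht2 _ _
      _ ≤ C * (‖h‖ * (t / 2) ^ (-α⁻¹)) ^ k *
          (C₁ * (2 * Real.pi)⁻¹ * (‖h‖ * (t / 2) ^ (-α⁻¹)) * ‖f‖) := by
          gcongr
          exact h1 _ ht2 _ _
      _ = _ := by
          rw [e2]
          ring

/-! ### A reproducing formula -/

/-- The symbol `exp (-t|2πξ|^α) ∑_{j < r} (t|2πξ|^α) ^ j / j!`. -/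
def taylorSymbol (n r : ℕ) (α t : ℝ) (ξ : E n) : ℂ :=
  ∑ j ∈ Finset.range r, ((t ^ j / j.factorial : ℝ) : ℂ) * heatSymbol n (α * j) α t ξ

lemma heatSymbol_mul_nat (α t : ℝ) (j : ℕ) (ξ : E n) :
    heatSymbol n (α * j) α t ξ = ((((2 * Real.pi * ‖ξ‖) ^ α) ^ j *
      Real.exp (-t * (2 * Real.pi * ‖ξ‖) ^ α) : ℝ) : ℂ) := by
  have hπ := Real.pi_pos
  rw [heatSymbol, Real.rpow_mul (by positivity), Real.rpow_natCast]

lemma taylorSymbol_eq (r : ℕ) (α t : ℝ) (ξ : E n) :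
    taylorSymbol n r α t ξ = ((∑ j ∈ Finset.range r,
      (t * (2 * Real.pi * ‖ξ‖) ^ α) ^ j / j.factorial *
        Real.exp (-(t * (2 * Real.pi * ‖ξ‖) ^ α)) : ℝ) : ℂ) := by
  rw [taylorSymbol, Complex.ofReal_sum]
  refine Finset.sum_congr rfl fun j _ => ?_
  rw [heatSymbol_mul_nat, ← Complex.ofReal_mul]
  congr 1
  rw [mul_pow, neg_mul]
  ring

lemma isGood_taylorSymbol (hn : 0 < n) (r : ℕ) {α t : ℝ} (hα : 0 < α) (ht : 0 < t) :
    IsGood (taylorSymbol n r α t) :=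
  IsGood.sum fun _ _ => (isGood_heatSymbol hn (by positivity) hα ht).const_mul _

lemma taylorSymbol_eq_dilate (r : ℕ) {α t : ℝ} (hα : 0 < α) (ht : 0 < t) :
    taylorSymbol n r α t = fun ξ => taylorSymbol n r α 1 (t ^ α⁻¹ • ξ) := by
  have hπ := Real.pi_pos
  ext ξ
  rw [taylorSymbol_eq, taylorSymbol_eq, norm_smul, Real.norm_of_nonneg (by positivity)]
  have : (2 * Real.pi * (t ^ α⁻¹ * ‖ξ‖)) ^ α = t * (2 * Real.pi * ‖ξ‖) ^ α := by
    rw [mul_left_comm, Real.mul_rpow (by positivity) (by positivity), ← Real.rpow_mul ht.le,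
      inv_mul_cancel₀ hα.ne', Real.rpow_one]
  rw [this, one_mul]

lemma taylorSymbol_zero {r : ℕ} (hr : 0 < r) {α : ℝ} (hα : 0 < α) (t : ℝ) :
    taylorSymbol n r α t 0 = 1 := by
  rw [taylorSymbol_eq, norm_zero, mul_zero, Real.zero_rpow hα.ne', mul_zero]
  rw [Finset.sum_eq_single_of_mem 0 (Finset.mem_range.2 hr)]
  · simp
  · intro j _ hj
    simp [hj]

/-- The symbol is 1 at the origin, so the kernel has integral 1, and the dilates form an approximate
identity. Convergence is pointwise, since f need not be uniformly continuous. -/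
lemma tendsto_op_taylorSymbol (hn : 0 < n) {r : ℕ} (hr : 0 < r) {α : ℝ} (hα : 0 < α)
    (f : E n →ᵇ ℂ) (x : E n) :
    Tendsto (fun t => op (taylorSymbol n r α t) f x) (𝓝[>] 0) (𝓝 (f x)) := by
  have hg := isGood_taylorSymbol hn r hα one_pos
  have h1 : f x = ∫ y, 𝓕⁻ (taylorSymbol n r α 1) y * f x := by
    have h0 := hg.eq_integral 0
    rw [taylorSymbol_zero hr hα] at h0
    simp only [inner_zero_right, neg_zero, AddChar.map_zero_eq_one, Circle.coe_one, one_mul] at h0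
    rw [integral_mul_const, ← h0, one_mul]
  rw [h1]
  have h2 : ∀ᶠ t in 𝓝[>] (0 : ℝ), ∫ y, 𝓕⁻ (taylorSymbol n r α 1) y * f (x - t ^ α⁻¹ • y) =
      op (taylorSymbol n r α t) f x := by
    filter_upwards [self_mem_nhdsWithin] with t (ht : 0 < t)
    rw [taylorSymbol_eq_dilate r hα ht, op_dilate_apply hg (by positivity)]
  refine Tendsto.congr' h2 ?_
  refine tendsto_integral_filter_of_dominated_convergence
    (fun y => ‖𝓕⁻ (taylorSymbol n r α 1) y‖ * ‖f‖) ?_ ?_ (hg.inv.norm.mul_const _) ?_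
  · refine Eventually.of_forall fun t => ?_
    refine hg.inv.aestronglyMeasurable.mul ?_
    exact (f.continuous.comp (by fun_prop)).aestronglyMeasurable
  · refine Eventually.of_forall fun t => Eventually.of_forall fun y => ?_
    rw [norm_mul]
    gcongr
    exact f.norm_coe_le_norm _
  · refine Eventually.of_forall fun y => ?_
    refine Tendsto.const_mul _ ?_
    have h3 : Tendsto (fun t : ℝ => t ^ α⁻¹) (𝓝[>] 0) (𝓝 0) := by
      have : ContinuousAt (fun t : ℝ => t ^ α⁻¹) 0 :=
        Real.continuousAt_rpow_const _ _ (Or.inr (by positivity))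
      have h4 := this.tendsto
      rw [Real.zero_rpow (by positivity)] at h4
      exact h4.mono_left nhdsWithin_le_nhds
    have h5 : Tendsto (fun t : ℝ => x - t ^ α⁻¹ • y) (𝓝[>] 0) (𝓝 x) := by
      simpa using (tendsto_const_nhds (x := x)).sub (h3.smul_const y)
    exact (f.continuous.tendsto x).comp h5

/-- The derivative telescopes, leaving only the top-order term. -/
lemma hasDerivAt_sum_pow_mul_exp (r : ℕ) (a t : ℝ) :
    HasDerivAt (fun t => ∑ j ∈ Finset.range (r + 1), (t * a) ^ j / j.factorial *
      Real.exp (-(t * a))) (-(t ^ r / r.factorial * (a ^ (r + 1) * Real.exp (-(t * a))))) t := by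
  have hx : HasDerivAt (fun t => t * a) a t := by simpa using (hasDerivAt_id t).mul_const a
  induction r with
  | zero =>
    simp only [zero_add, Finset.range_one, Finset.sum_singleton, pow_zero, Nat.factorial_zero,
      Nat.cast_one, div_one, one_mul, pow_one]
    exact hx.fun_neg.exp.congr_deriv (by ring)
  | succ r ih =>
    simp only [Finset.sum_range_succ _ (r + 1)]
    have h1 := ((hx.pow (r + 1)).div_const ((r + 1).factorial : ℝ)).mul hx.fun_neg.exp
    refine (ih.add h1).congr_deriv ?_
    have h0 : ((r + 1 : ℕ) : ℝ) ≠ 0 := by positivity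
    have h2 : (r.factorial : ℝ) ≠ 0 := by positivity
    simp only [Nat.add_sub_cancel, Nat.factorial_succ]
    push_cast at h0 ⊢
    simp only [Pi.pow_apply]
    field_simp
    ring

lemma taylorSymbol_sub (r : ℕ) (α : ℝ) {t t' : ℝ} (ξ : E n) :
    taylorSymbol n (r + 1) α t ξ - taylorSymbol n (r + 1) α t' ξ =
      ∫ u in t..t', ((u ^ r / r.factorial : ℝ) : ℂ) *
        heatSymbol n (α * (r + 1 : ℕ)) α u ξ := by
  set a := (2 * Real.pi * ‖ξ‖) ^ α with ha
  have h := intervalIntegral.integral_eq_sub_of_hasDerivAt (a := t) (b := t')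
    (fun u _ => hasDerivAt_sum_pow_mul_exp r a u)
    (Continuous.intervalIntegrable (by fun_prop) _ _)
  rw [intervalIntegral.integral_neg] at h
  rw [taylorSymbol_eq, taylorSymbol_eq, ← ha, ← Complex.ofReal_sub, ← neg_sub, ← h, neg_neg,
    ← intervalIntegral.integral_ofReal]
  congr 1 with u
  rw [heatSymbol_mul_nat, ← Complex.ofReal_mul, ← ha, neg_mul]

section Reproducing

variable {r : ℕ} {α t t' : ℝ}

lemma norm_heatSymbol_anti {b α t u : ℝ} (h : t ≤ u) (ξ : E n) :
    ‖heatSymbol n b α u ξ‖ ≤ ‖heatSymbol n b α t ξ‖ := by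
  have hπ := Real.pi_pos
  simp only [heatSymbol, Complex.norm_real]
  rw [Real.norm_of_nonneg (by positivity), Real.norm_of_nonneg (by positivity)]
  gcongr

lemma integrable_heatSymbol_prod (hn : 0 < n) {b : ℝ} (hb : 0 ≤ b) (hα : 0 < α) (ht : 0 < t) :
    Integrable (fun p : E n × ℝ => ((p.2 ^ r / r.factorial : ℝ) : ℂ) * heatSymbol n b α p.2 p.1)
      (volume.prod (volume.restrict (Ioc t t'))) := by
  have h0 : Integrable (fun p : E n × ℝ => ‖heatSymbol n b α t p.1‖ * (t' ^ r / r.factorial))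
      (volume.prod (volume.restrict (Ioc t t'))) :=
    (isGood_heatSymbol hn hb hα ht).int.norm.mul_prod
      (integrable_const (μ := volume.restrict (Ioc t t')) (t' ^ r / r.factorial : ℝ))
  have hmeas : Measurable fun p : E n × ℝ =>
      ((p.2 ^ r / r.factorial : ℝ) : ℂ) * heatSymbol n b α p.2 p.1 := by
    unfold heatSymbol
    fun_prop
  refine h0.mono' hmeas.aestronglyMeasurable ?_
  have h2 : ∀ᵐ p : E n × ℝ ∂(volume.prod (volume.restrict (Ioc t t'))), p.2 ∈ Ioc t t' :=
    Measure.quasiMeasurePreserving_snd.ae (ae_restrict_mem measurableSet_Ioc)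
  filter_upwards [h2] with p hp
  have hp0 : 0 < p.2 := ht.trans hp.1
  rw [norm_mul, Complex.norm_real, Real.norm_of_nonneg (by positivity), mul_comm]
  gcongr
  · exact norm_heatSymbol_anti hp.1.le _
  · exact hp.2

lemma fourierInv_taylorSymbol_sub (hn : 0 < n) (hα : 0 < α) (ht : 0 < t) (htt : t ≤ t')
    (y : E n) :
    𝓕⁻ (taylorSymbol n (r + 1) α t) y - 𝓕⁻ (taylorSymbol n (r + 1) α t') y =
      ∫ u in Ioc t t', ((u ^ r / r.factorial : ℝ) : ℂ) *
        𝓕⁻ (heatSymbol n (α * (r + 1 : ℕ)) α u) y := by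
  have hb : 0 ≤ α * (r + 1 : ℕ) := by positivity
  rw [fourierInv_apply, fourierInv_apply, ← integral_sub
    (integrable_char_mul (isGood_taylorSymbol hn _ hα ht).int (by fun_prop))
    (integrable_char_mul (isGood_taylorSymbol hn _ hα (ht.trans_le htt)).int (by fun_prop))]
  simp_rw [← mul_sub, taylorSymbol_sub, intervalIntegral.integral_of_le htt,
    ← integral_const_mul]
  rw [integral_integral_swap]
  · congr 1 with u
    rw [fourierInv_apply, ← integral_const_mul]
    congr 1 with ξ
    ring
  · refine (integrable_heatSymbol_prod hn hb hα ht).bdd_mul (c := 1)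
      (f := fun p : E n × ℝ => (𝐞 (inner ℝ p.1 y) : ℂ))
      (continuous_char (by fun_prop)).aestronglyMeasurable
      (Eventually.of_forall fun y => (norm_char _).le)

lemma fourierInv_heatSymbol_apply {b : ℝ} (hα : 0 < α) (ht : 0 < t) (y : E n) :
    𝓕⁻ (heatSymbol n b α t) y = ((t ^ (-(b / α)) : ℝ) : ℂ) *
      (((heatScale α t ^ n)⁻¹ : ℝ) • 𝓕⁻ (expSymbol n b α) ((heatScale α t)⁻¹ • y)) := by
  rw [heatSymbol_eq_dilate b hα.ne' ht, fourierInv_const_mul]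
  beta_reduce
  rw [fourierInv_dilate _ (heatScale_pos α ht).ne', abs_of_pos (heatScale_pos α ht)]

lemma integrable_heatKernel_prod (hn : 0 < n) {b : ℝ} (hb : 0 ≤ b) (hα : 0 < α) (ht : 0 < t) :
    Integrable (fun p : E n × ℝ =>
      ((p.2 ^ r / r.factorial : ℝ) : ℂ) * 𝓕⁻ (heatSymbol n b α p.2) p.1)
      (volume.prod (volume.restrict (Ioc t t'))) := by
  have hpos : ∀ᵐ u ∂(volume.restrict (Ioc t t')), u ∈ Ioc t t' :=
    ae_restrict_mem measurableSet_Ioc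
  have hmeas : AEStronglyMeasurable (fun p : E n × ℝ =>
      ((p.2 ^ r / r.factorial : ℝ) : ℂ) * 𝓕⁻ (heatSymbol n b α p.2) p.1)
      (volume.prod (volume.restrict (Ioc t t'))) := by
    -- Joint measurability in space and time is read off from the explicit dilation formula, valid
    -- for positive time.
    have h1 : Measurable fun p : E n × ℝ => ((p.2 ^ r / r.factorial : ℝ) : ℂ) *
        (((p.2 ^ (-(b / α)) : ℝ) : ℂ) * (((heatScale α p.2 ^ n)⁻¹ : ℝ) •
          𝓕⁻ (expSymbol n b α) ((heatScale α p.2)⁻¹ • p.1))) := by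
      have h3 : Measurable fun p : E n × ℝ => (heatScale α p.2)⁻¹ • p.1 := by
        unfold heatScale
        fun_prop
      have h4 : Measurable fun p : E n × ℝ => (heatScale α p.2 ^ n)⁻¹ := by
        unfold heatScale
        fun_prop
      have h5 := (isGood_expSymbol hn hb hα).continuous_inv.measurable.comp h3
      have h6 : Measurable fun p : E n × ℝ => ((p.2 ^ (-(b / α)) : ℝ) : ℂ) := by fun_prop
      have h7 : Measurable fun p : E n × ℝ => ((p.2 ^ r / r.factorial : ℝ) : ℂ) := by fun_prop
      exact h7.mul (h6.mul (h4.smul h5))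
    refine h1.aestronglyMeasurable.congr ?_
    have h2 : ∀ᵐ p : E n × ℝ ∂(volume.prod (volume.restrict (Ioc t t'))), p.2 ∈ Ioc t t' :=
      Measure.quasiMeasurePreserving_snd.ae hpos
    filter_upwards [h2] with p hp
    rw [fourierInv_heatSymbol_apply hα (ht.trans hp.1)]
  rw [integrable_prod_iff' hmeas]
  constructor
  · filter_upwards [hpos] with u hu
    exact (isGood_heatSymbol hn hb hα (ht.trans hu.1)).inv.const_mul _
  · have hc : ContinuousOn (fun u : ℝ => u ^ r / r.factorial * (expNorm n b α * u ^ (-(b / α))))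
        (Icc t t') := by
      refine ContinuousOn.mul (by fun_prop) (ContinuousOn.mul continuousOn_const ?_)
      exact fun u hu => (Real.continuousAt_rpow_const _ _
        (Or.inl (ht.trans_le hu.1).ne')).continuousWithinAt
    have hi := (hc.integrableOn_Icc (μ := volume)).mono_set Ioc_subset_Icc_self
    refine hi.congr ?_
    filter_upwards [hpos] with u hu
    have hu0 := ht.trans hu.1
    simp only [norm_mul, Complex.norm_real]
    rw [integral_const_mul, integral_norm_fourierInv_heatSymbol hα hu0,
      Real.norm_of_nonneg (by positivity)]

lemma op_taylorSymbol_sub (hn : 0 < n) (hα : 0 < α) (ht : 0 < t) (htt : t ≤ t')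
    (f : E n →ᵇ ℂ) (x : E n) :
    op (taylorSymbol n (r + 1) α t) f x - op (taylorSymbol n (r + 1) α t') f x =
      ∫ u in Ioc t t', ((u ^ r / r.factorial : ℝ) : ℂ) *
        op (heatSymbol n (α * (r + 1 : ℕ)) α u) f x := by
  have hb : 0 ≤ α * (r + 1 : ℕ) := by positivity
  have h1 := (isGood_taylorSymbol hn (r + 1) hα ht).inv
  have h2 := (isGood_taylorSymbol hn (r + 1) hα (ht.trans_le htt)).inv
  rw [op, op, conv_apply h1, conv_apply h2,
    ← integral_sub (integrable_kernel_mul h1 f x) (integrable_kernel_mul h2 f x)]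
  simp_rw [← sub_mul, fourierInv_taylorSymbol_sub hn hα ht htt, ← integral_mul_const]
  rw [integral_integral_swap]
  · refine setIntegral_congr_fun measurableSet_Ioc fun u hu => ?_
    rw [op, conv_apply (isGood_heatSymbol hn hb hα (ht.trans hu.1)).inv, ← integral_const_mul]
    congr 1 with y
    ring
  · refine (integrable_heatKernel_prod hn hb hα ht).mul_bdd (c := ‖f‖) ?_
      (Eventually.of_forall fun p => f.norm_coe_le_norm _)
    exact (f.continuous.comp (by fun_prop)).aestronglyMeasurable

end Reproducing

/-! ### From the heat semigroup to differences -/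

/-- Split at u = τ, where the two functions agree, and keep on each side the one that is integrable
there. -/
lemma integral_min_rpow_le {p q τ : ℝ} (hp : 0 < p) (hq : 0 < q) (hτ : 0 < τ) :
    IntegrableOn (fun u : ℝ => min (u ^ (p - 1)) (τ ^ (p + q) * u ^ (-q - 1))) (Ioi 0) ∧
      ∫ u in Ioi 0, min (u ^ (p - 1)) (τ ^ (p + q) * u ^ (-q - 1)) ≤ (p⁻¹ + q⁻¹) * τ ^ p := by
  have hm : Measurable fun u : ℝ => min (u ^ (p - 1)) (τ ^ (p + q) * u ^ (-q - 1)) := by fun_prop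
  have i1 : IntegrableOn (fun u : ℝ => u ^ (p - 1)) (Ioc 0 τ) :=
    (intervalIntegral.intervalIntegrable_rpow' (by linarith) (a := 0) (b := τ)).1
  have i2 : IntegrableOn (fun u : ℝ => τ ^ (p + q) * u ^ (-q - 1)) (Ioi τ) :=
    (integrableOn_Ioi_rpow_of_lt (by linarith) hτ).const_mul _
  have hnn : ∀ u : ℝ, 0 < u → 0 ≤ min (u ^ (p - 1)) (τ ^ (p + q) * u ^ (-q - 1)) :=
    fun u hu => by positivity
  have j1 : IntegrableOn (fun u : ℝ => min (u ^ (p - 1)) (τ ^ (p + q) * u ^ (-q - 1)))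
      (Ioc 0 τ) := by
    refine i1.mono' hm.aestronglyMeasurable ?_
    filter_upwards [ae_restrict_mem measurableSet_Ioc] with u hu
    rw [Real.norm_of_nonneg (hnn u hu.1)]
    exact min_le_left _ _
  have j2 : IntegrableOn (fun u : ℝ => min (u ^ (p - 1)) (τ ^ (p + q) * u ^ (-q - 1)))
      (Ioi τ) := by
    refine i2.mono' hm.aestronglyMeasurable ?_
    filter_upwards [ae_restrict_mem measurableSet_Ioi] with u hu
    rw [Real.norm_of_nonneg (hnn u (hτ.trans hu))]
    exact min_le_right _ _
  rw [← Ioc_union_Ioi_eq_Ioi hτ.le]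
  refine ⟨j1.union j2, ?_⟩
  rw [setIntegral_union (Ioc_disjoint_Ioi le_rfl) measurableSet_Ioi j1 j2, add_mul]
  refine add_le_add ?_ ?_
  · refine (setIntegral_mono j1 i1 fun u => min_le_left _ _).trans (le_of_eq ?_)
    rw [← intervalIntegral.integral_of_le hτ.le, integral_rpow (Or.inl (by linarith))]
    rw [sub_add_cancel, Real.zero_rpow hp.ne']
    field_simp
    ring
  · refine (setIntegral_mono j2 i2 fun u => min_le_right _ _).trans (le_of_eq ?_)
    rw [integral_const_mul, integral_Ioi_rpow_of_lt (by linarith) hτ, sub_add_cancel,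
      Real.rpow_add hτ, Real.rpow_neg hτ.le]
    field_simp

/-- In each term t^j A^j e^{-tA}, one half of the semigroup absorbs t^j A^j and the other gives
Δ_h^k the factor (|h| t^{-1/α})^k. This limit removes the contribution at infinity from the
reproducing formula. -/
lemma tendsto_bdiff_pow_taylorSymbol (hn : 0 < n) {α : ℝ} (hα : 0 < α) {k r : ℕ} (hk : 0 < k)
    (h : E n) (f : E n →ᵇ ℂ) :
    Tendsto (fun t => ‖(bdiff h ^ k) (op (taylorSymbol n r α t) f)‖) atTop (𝓝 0) := by
  obtain ⟨C, hC, hC'⟩ := exists_norm_bdiff_pow_heat_le hn hα k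
  have key : ∀ t : ℝ, 0 < t → ‖(bdiff h ^ k) (op (taylorSymbol n r α t) f)‖ ≤
      ∑ j ∈ Finset.range r, (2 ^ j / j.factorial) *
        (C * (‖h‖ * (t / 2) ^ (-α⁻¹)) ^ k * (expNorm n (α * j) α * ‖f‖)) := by
    intro t ht
    have ht2 := half_pos ht
    unfold taylorSymbol
    rw [op_sum_left fun j _ => (isGood_heatSymbol hn (by positivity) hα ht).const_mul _, map_sum]
    refine (norm_sum_le _ _).trans (Finset.sum_le_sum fun j _ => ?_)
    have hb : 0 ≤ α * j := by positivity
    rw [op_const_mul _ (isGood_heatSymbol hn hb hα ht), map_smul, norm_smul, Complex.norm_real,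
      Real.norm_of_nonneg (by positivity)]
    have e := op_heatSymbol_add hn le_rfl hb hα ht2 ht2 f
    rw [zero_add, add_halves] at e
    rw [e]
    have h1 := hC' _ ht2 h (op (heatSymbol n (α * j) α (t / 2)) f)
    have h2 := norm_op_heatSymbol_le hn hb hα ht2 f
    have h3 : (t / 2) ^ (-(α * j / α)) = 2 ^ j / t ^ j := by
      rw [mul_div_cancel_left₀ _ hα.ne', Real.rpow_neg ht2.le, Real.rpow_natCast, div_pow, inv_div]
    rw [h3] at h2
    calc _ ≤ t ^ j / j.factorial * (C * (‖h‖ * (t / 2) ^ (-α⁻¹)) ^ k *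
          (expNorm n (α * j) α * (2 ^ j / t ^ j) * ‖f‖)) := by
          gcongr
          refine h1.trans ?_
          gcongr
      _ = _ := by
          have : t ^ j ≠ 0 := by positivity
          field_simp
  have h0 : Tendsto (fun t : ℝ => ∑ j ∈ Finset.range r, (2 ^ j / j.factorial) *
        (C * (‖h‖ * (t / 2) ^ (-α⁻¹)) ^ k * (expNorm n (α * j) α * ‖f‖))) atTop (𝓝 0) := by
    have h1 : Tendsto (fun t : ℝ => (t / 2) ^ (-α⁻¹)) atTop (𝓝 0) :=
      (tendsto_rpow_neg_atTop (by positivity)).comp (tendsto_id.atTop_div_const two_pos)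
    have h2 := (h1.const_mul ‖h‖).pow k
    rw [mul_zero, zero_pow hk.ne'] at h2
    rw [show (0 : ℝ) = ∑ j ∈ Finset.range r, (2 ^ j / j.factorial : ℝ) *
      (C * 0 * (expNorm n (α * j) α * ‖f‖)) by simp]
    exact tendsto_finsetSum _ fun j _ => ((h2.const_mul C).mul_const _).const_mul _
  refine squeeze_zero' (Eventually.of_forall fun t => norm_nonneg _) ?_ h0
  filter_upwards [eventually_gt_atTop 0] with t ht
  exact key t ht

theorem exists_norm_bdiff_pow_le_of_heat (hn : 0 < n) {α s : ℝ} (hα : 0 < α) (hs : 0 < s)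
    (r : ℕ) {k : ℕ} (hk : s < k) :
    ∃ C : ℝ, 0 ≤ C ∧ ∀ (f : E n →ᵇ ℂ) (S : ℝ), 0 ≤ S →
      (∀ t : ℝ, 0 < t → ‖op (heatSymbol n (α * (r + 1 : ℕ)) α t) f‖ ≤
        S * t ^ (s / α - (r + 1 : ℕ))) →
      ∀ h x : E n, ‖(bdiff h ^ k) f x‖ ≤ C * S * ‖h‖ ^ s := by
  obtain ⟨C, hC, hC'⟩ := exists_norm_bdiff_pow_heat_le hn hα k
  have hk0 : 0 < k := by
    have : (0 : ℝ) < k := hs.trans hk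
    exact_mod_cast this
  -- The first entry bounds Δ_h^k crudely; the second comes from the smoothing bound after halving
  -- the time.
  set A : ℝ := max (2 ^ k) (C * 2 ^ (α⁻¹ * k) * 2 ^ ((r + 1 : ℕ) - s / α)) with hA
  have hA0 : 0 ≤ A := le_max_of_le_left (by positivity)
  set p := s / α with hp
  set q := (k - s) / α with hq
  have hp0 : 0 < p := by positivity
  have hq0 : 0 < q := div_pos (by linarith) hα
  have hpq : p + q = k / α := by rw [hp, hq, ← add_div]; ring
  refine ⟨A * (p⁻¹ + q⁻¹), by positivity, fun f S hS hf h x => ?_⟩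
  rcases eq_or_ne h 0 with rfl | hh
  · rw [bdiff_zero, zero_pow hk0.ne', norm_zero, Real.zero_rpow hs.ne']
    simp
  have hh0 : 0 < ‖h‖ := norm_pos_iff.2 hh
  set g := (bdiff h ^ k) f with hg
  -- The crude bound and the smoothing bound cross at time |h|^α.
  set τ := ‖h‖ ^ α with hτ
  have hτ0 : 0 < τ := by positivity
  have hτp : τ ^ p = ‖h‖ ^ s := by
    rw [hτ, ← Real.rpow_mul hh0.le, hp, mul_div_cancel₀ _ hα.ne']
  have hτpq : τ ^ (p + q) = ‖h‖ ^ k := by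
    rw [hτ, ← Real.rpow_mul hh0.le, hpq, mul_div_cancel₀ _ hα.ne', Real.rpow_natCast]
  have hb : 0 ≤ α * (r + 1 : ℕ) := by positivity
  set w : ℝ → ℝ := fun u => min (u ^ (p - 1)) (τ ^ (p + q) * u ^ (-q - 1)) with hw
  obtain ⟨hwi, hwI⟩ := integral_min_rpow_le hp0 hq0 hτ0
  have hbound : ∀ u : ℝ, 0 < u → ‖((u ^ r / r.factorial : ℝ) : ℂ) *
      op (heatSymbol n (α * (r + 1 : ℕ)) α u) g x‖ ≤ A * S * w u := by
    intro u hu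
    have hu2 := half_pos hu
    have hfac : (1 : ℝ) ≤ r.factorial := by exact_mod_cast r.factorial_pos
    have e0 : u ^ r / r.factorial ≤ u ^ r := div_le_self (by positivity) hfac
    have eg : op (heatSymbol n (α * (r + 1 : ℕ)) α u) g =
        (bdiff h ^ k) (op (heatSymbol n (α * (r + 1 : ℕ)) α u) f) := by
      rw [bdiff_pow_op (isGood_heatSymbol hn hb hα hu)]
    have b1 : ‖op (heatSymbol n (α * (r + 1 : ℕ)) α u) g‖ ≤ A * (S * u ^ (p - (r + 1 : ℕ))) := by
      rw [eg]
      refine (norm_bdiff_pow_le h k _).trans ?_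
      gcongr
      · exact le_max_left _ _
      · exact hf u hu
    have b2 : ‖op (heatSymbol n (α * (r + 1 : ℕ)) α u) g‖ ≤
        A * (S * u ^ (p - (r + 1 : ℕ))) * (τ ^ (p + q) * u ^ (-(p + q))) := by
      have e := op_heatSymbol_add hn le_rfl hb hα hu2 hu2 f
      rw [zero_add, add_halves] at e
      rw [eg, e]
      refine (hC' _ hu2 h _).trans ?_
      calc C * (‖h‖ * (u / 2) ^ (-α⁻¹)) ^ k * ‖op (heatSymbol n (α * (r + 1 : ℕ)) α (u / 2)) f‖
          ≤ C * (‖h‖ * (u / 2) ^ (-α⁻¹)) ^ k * (S * (u / 2) ^ (p - (r + 1 : ℕ))) := by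
            gcongr
            exact hf _ hu2
        _ = (C * 2 ^ (α⁻¹ * k) * 2 ^ ((r + 1 : ℕ) - p)) * (S * u ^ (p - (r + 1 : ℕ))) *
            (‖h‖ ^ k * u ^ (-(k / α))) := by
            rw [mul_pow, ← Real.rpow_natCast ((u / 2) ^ (-α⁻¹)) k, ← Real.rpow_mul hu2.le,
              Real.div_rpow hu.le zero_le_two, Real.div_rpow hu.le zero_le_two,
              show -α⁻¹ * (k : ℝ) = -(α⁻¹ * k) by ring,
              show p - ((r + 1 : ℕ) : ℝ) = -(((r + 1 : ℕ) : ℝ) - p) by ring,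
              Real.rpow_neg zero_le_two, Real.rpow_neg zero_le_two,
              show -((k : ℝ) / α) = -(α⁻¹ * k) by ring]
            field_simp
        _ ≤ _ := by
            rw [← hpq, hτpq]
            gcongr
            exact le_max_right _ _
    rw [norm_mul, Complex.norm_real, Real.norm_of_nonneg (by positivity)]
    have e1 : u ^ r * u ^ (p - (r + 1 : ℕ)) = u ^ (p - 1) := by
      rw [← Real.rpow_natCast, ← Real.rpow_add hu]
      congr 1
      push_cast
      ring
    have e2 : u ^ (p - 1) * u ^ (-(p + q)) = u ^ (-q - 1) := by
      rw [← Real.rpow_add hu]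
      congr 1
      ring
    have hx := (op (heatSymbol n (α * (r + 1 : ℕ)) α u) g).norm_coe_le_norm x
    rw [hw, mul_min_of_nonneg _ _ (by positivity)]
    refine le_min ?_ ?_
    · calc _ ≤ u ^ r * (A * (S * u ^ (p - (r + 1 : ℕ)))) := by
            gcongr
            exact hx.trans b1
        _ = A * S * (u ^ r * u ^ (p - (r + 1 : ℕ))) := by ring
        _ = _ := by rw [e1]
    · calc _ ≤ u ^ r * (A * (S * u ^ (p - (r + 1 : ℕ))) * (τ ^ (p + q) * u ^ (-(p + q)))) := by
            gcongr
            exact hx.trans b2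
        _ = A * S * (τ ^ (p + q) * (u ^ r * u ^ (p - (r + 1 : ℕ)) * u ^ (-(p + q)))) := by ring
        _ = _ := by rw [e1, e2]
  have hmain : ∀ t t' : ℝ, 0 < t → t ≤ t' → ‖op (taylorSymbol n (r + 1) α t) g x‖ ≤
      A * S * ((p⁻¹ + q⁻¹) * τ ^ p) +
        ‖(bdiff h ^ k) (op (taylorSymbol n (r + 1) α t') f)‖ := by
    intro t t' ht htt
    have h1 := op_taylorSymbol_sub (r := r) hn hα ht htt g x
    rw [sub_eq_iff_eq_add] at h1
    rw [h1]
    refine (norm_add_le _ _).trans (add_le_add ?_ ?_)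
    · have hwi' : IntegrableOn (fun u => A * S * w u) (Ioc t t') :=
        (hwi.mono_set fun u hu => ht.trans hu.1).const_mul (A * S)
      refine (norm_integral_le_of_norm_le hwi' ?_).trans ?_
      · filter_upwards [ae_restrict_mem measurableSet_Ioc] with u hu
        exact hbound u (ht.trans hu.1)
      · rw [integral_const_mul]
        refine mul_le_mul_of_nonneg_left (le_trans ?_ hwI) (by positivity)
        refine setIntegral_mono_set hwi ?_ (Eventually.of_forall fun u hu => ht.trans hu.1)
        filter_upwards [ae_restrict_mem measurableSet_Ioi] with u (hu : 0 < u)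
        simp only [hw, Pi.zero_apply]
        positivity
    · rw [bdiff_pow_op (isGood_taylorSymbol hn _ hα (ht.trans_le htt))]
      exact BoundedContinuousFunction.norm_coe_le_norm _ _
  -- The upper time t' tends to infinity here; afterwards t tends to 0.
  have hstep : ∀ t : ℝ, 0 < t → ‖op (taylorSymbol n (r + 1) α t) g x‖ ≤
      A * S * ((p⁻¹ + q⁻¹) * τ ^ p) := by
    intro t ht
    have hl := (tendsto_bdiff_pow_taylorSymbol (r := r + 1) hn hα hk0 h f).const_add
      (A * S * ((p⁻¹ + q⁻¹) * τ ^ p))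
    rw [add_zero] at hl
    refine ge_of_tendsto hl ?_
    filter_upwards [eventually_ge_atTop t] with t' ht'
    exact hmain t t' ht ht'
  have hfin := le_of_tendsto (tendsto_op_taylorSymbol hn (Nat.succ_pos r) hα g x).norm
    (eventually_nhdsWithin_of_forall fun t ht => hstep t ht)
  refine hfin.trans (le_of_eq ?_)
  rw [hτp]
  ring

/-! ### Approximation by smooth averages -/

lemma bdiff_pow_eq_fwdDiff (h : E n) (k : ℕ) (f : E n →ᵇ ℂ) (x : E n) :
    (bdiff h ^ k) f x = (fwdDiff h)^[k] f (x - ((k : ℝ) / 2) • h) := by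
  induction k generalizing x with
  | zero => simp
  | succ k ih =>
    have e₁ : x + (2⁻¹ : ℝ) • h - ((k : ℝ) / 2) • h = x - (((k + 1 : ℕ) : ℝ) / 2) • h + h := by
      push_cast
      module
    have e₂ : x - (2⁻¹ : ℝ) • h - ((k : ℝ) / 2) • h = x - (((k + 1 : ℕ) : ℝ) / 2) • h := by
      push_cast
      module
    rw [pow_succ', Module.End.mul_apply, bdiff_apply, ih, ih, Function.iterate_succ_apply', fwdDiff,
      e₁, e₂]

lemma bdiff_pow_two_mul_apply (h : E n) (m : ℕ) (f : E n →ᵇ ℂ) (x : E n) :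
    (bdiff h ^ (2 * m)) f x = ∑ j ∈ Finset.range (2 * m + 1),
      ((-1) ^ j * ((2 * m).choose j : ℂ)) * f (x - ((m : ℝ) - j) • h) := by
  rw [bdiff_pow_eq_fwdDiff, fwdDiff_iter_eq_sum_shift]
  refine Finset.sum_congr rfl fun j hj => ?_
  have hj' : j ≤ 2 * m := by simpa [Nat.lt_succ_iff] using hj
  have e1 : (-1 : ℂ) ^ (2 * m - j) = (-1) ^ j := by
    have : (-1 : ℂ) ^ (2 * m - j) * (-1) ^ j = 1 := by
      rw [← pow_add, Nat.sub_add_cancel hj', pow_mul]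
      simp
    have h2 : (-1 : ℂ) ^ j * (-1) ^ j = 1 := by rw [← mul_pow]; simp
    have h3 : (-1 : ℂ) ^ j ≠ 0 := by simp
    exact mul_right_cancel₀ h3 (this.trans h2.symm)
  rw [zsmul_eq_mul]
  push_cast
  rw [e1]
  congr 2
  module

lemma exists_schwartz_eq_one (n : ℕ) : ∃ ψ : 𝓢(E n, ℂ), ψ 0 = 1 := by
  let b : ContDiffBump (0 : E n) := ⟨1, 2, one_pos, one_lt_two⟩
  have h₁ : HasCompactSupport (Complex.ofRealCLM ∘ b) := b.hasCompactSupport.comp_left rfl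
  have h₂ : ContDiff ℝ ((⊤ : ℕ∞) : WithTop ℕ∞) (Complex.ofRealCLM ∘ b) := Complex.ofRealCLM.contDiff.comp b.contDiff
  refine ⟨h₁.toSchwartzMap h₂, ?_⟩
  have : b 0 = 1 := b.one_of_mem_closedBall (by simp [b])
  simp [this]

lemma integrable_norm_rpow_mul_schwartz (ψ : 𝓢(E n, ℂ)) {s : ℝ} (hs : 0 ≤ s) :
    Integrable fun x => ‖ψ x‖ * ‖x‖ ^ s := by
  have h0 := (ψ.integrable (μ := volume)).norm
  have h1 := ψ.integrable_pow_mul volume ⌈s⌉₊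
  refine (h0.add h1).mono' ?_ (Eventually.of_forall fun x => ?_)
  · exact (ψ.continuous.norm.mul (continuous_norm.rpow_const fun _ =>
      Or.inr hs)).aestronglyMeasurable
  · simp only [Pi.add_apply]
    rw [Real.norm_of_nonneg (by positivity), mul_comm (‖x‖ ^ ⌈s⌉₊), ← mul_one_add]
    gcongr
    rcases le_total ‖x‖ 1 with hx | hx
    · have := Real.rpow_le_one (norm_nonneg x) hx hs
      have : 0 ≤ ‖x‖ ^ ⌈s⌉₊ := by positivity
      linarith
    · have := Real.rpow_le_rpow_of_exponent_le hx (Nat.le_ceil s)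
      rw [Real.rpow_natCast] at this
      linarith

/-- The symbol of the averaging operator adapted to symmetric differences of order `2 * m`. -/
def avgSymbol (ψ : 𝓢(E n, ℂ)) (m : ℕ) (ξ : E n) : ℂ :=
  ∑ j ∈ (Finset.range (2 * m + 1)).erase m,
    (-((-1) ^ m / ((2 * m).choose m : ℂ)) * ((-1) ^ j * ((2 * m).choose j : ℂ))) *
      ψ (((m : ℝ) - j) • ξ)

lemma sub_ne_zero_of_mem_erase {m j : ℕ} (hj : j ∈ (Finset.range (2 * m + 1)).erase m) :
    (m : ℝ) - j ≠ 0 := by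
  have := (Finset.mem_erase.1 hj).1
  rw [sub_ne_zero]
  exact_mod_cast this.symm

lemma isGood_avgSymbol (ψ : 𝓢(E n, ℂ)) (m : ℕ) : IsGood (avgSymbol ψ m) :=
  IsGood.sum fun _ hj => ((isGood_schwartz ψ).dilate (sub_ne_zero_of_mem_erase hj)).const_mul _

/-- By homogeneity each summand is a dilate of |2πξ|^β ψ. The omitted index j = m would be a
dilation by 0. -/
lemma isGood_rpow_mul_avgSymbol (hn : 0 < n) {β : ℝ} (hβ : 0 < β) (ψ : 𝓢(E n, ℂ)) (m : ℕ) :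
    IsGood (fun ξ : E n => (((2 * Real.pi * ‖ξ‖) ^ β : ℝ) : ℂ) * avgSymbol ψ m ξ) := by
  have h : (fun ξ : E n => (((2 * Real.pi * ‖ξ‖) ^ β : ℝ) : ℂ) * avgSymbol ψ m ξ) =
      fun ξ => ∑ j ∈ (Finset.range (2 * m + 1)).erase m,
        ((-((-1) ^ m / ((2 * m).choose m : ℂ)) * ((-1) ^ j * ((2 * m).choose j : ℂ))) *
          ((|(m : ℝ) - j| ^ (-β) : ℝ) : ℂ)) *
        ((((2 * Real.pi * ‖((m : ℝ) - j) • ξ‖) ^ β : ℝ) : ℂ) * ψ (((m : ℝ) - j) • ξ)) := by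
    ext ξ
    rw [avgSymbol, Finset.mul_sum]
    refine Finset.sum_congr rfl fun j hj => ?_
    have hπ := Real.pi_pos
    have h0 : 0 < |(m : ℝ) - j| := abs_pos.2 (sub_ne_zero_of_mem_erase hj)
    have e : (2 * Real.pi * ‖ξ‖) ^ β =
        |(m : ℝ) - j| ^ (-β) * (2 * Real.pi * ‖((m : ℝ) - j) • ξ‖) ^ β := by
      rw [norm_smul, mul_left_comm, Real.norm_eq_abs, Real.mul_rpow h0.le (by positivity),
        ← mul_assoc, ← Real.rpow_add h0]
      simp
    rw [e]
    push_cast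
    ring
  rw [h]
  refine IsGood.sum fun j hj => IsGood.const_mul _ ?_
  exact (isGood_rpow_mul_schwartz hn hβ ψ).dilate (sub_ne_zero_of_mem_erase hj)

/-- In the expansion of Δ_{δy}^{2m} f(x) the central term is (-1)^m C(2m, m) f(x), independent of y.
Since the kernel has integral ψ(0) = 1, dividing by this coefficient isolates f(x), and the other
terms form the average. An even order is needed for x to be one of the nodes. -/
lemma sub_op_avgSymbol_apply {ψ : 𝓢(E n, ℂ)} (hψ : ψ 0 = 1) (m : ℕ) {δ : ℝ} (hδ : 0 < δ)
    (f : E n →ᵇ ℂ) (x : E n) :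
    f x - op (fun ξ => avgSymbol ψ m (δ • ξ)) f x =
      ((-1) ^ m / ((2 * m).choose m : ℂ)) *
        ∫ y, 𝓕⁻ (ψ : E n → ℂ) y * (bdiff (δ • y) ^ (2 * m)) f x := by
  have hg := isGood_schwartz ψ
  have hc : ((2 * m).choose m : ℂ) ≠ 0 := by
    exact_mod_cast (Nat.choose_pos (by omega)).ne'
  have hone : ∫ y, 𝓕⁻ (ψ : E n → ℂ) y = 1 := by
    have h0 := hg.eq_integral 0
    simp only [inner_zero_right, neg_zero, AddChar.map_zero_eq_one, Circle.coe_one, one_mul] at h0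
    rw [← h0, hψ]
  have hi : ∀ l : ℝ, Integrable fun y => 𝓕⁻ (ψ : E n → ℂ) y * f (x - l • y) := by
    intro l
    refine hg.inv.mul_bdd (c := ‖f‖) ?_ (Eventually.of_forall fun y => f.norm_coe_le_norm _)
    exact (f.continuous.comp (by fun_prop)).aestronglyMeasurable
  have h1 : ∫ y, 𝓕⁻ (ψ : E n → ℂ) y * (bdiff (δ • y) ^ (2 * m)) f x =
      ∑ j ∈ Finset.range (2 * m + 1), ((-1) ^ j * ((2 * m).choose j : ℂ)) *
        ∫ y, 𝓕⁻ (ψ : E n → ℂ) y * f (x - (((m : ℝ) - j) * δ) • y) := by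
    simp_rw [bdiff_pow_two_mul_apply, Finset.mul_sum, smul_smul]
    rw [integral_finsetSum]
    · refine Finset.sum_congr rfl fun j _ => ?_
      rw [← integral_const_mul]
      congr 1 with y
      ring
    · intro j _
      refine ((hi (((m : ℝ) - j) * δ)).const_mul ((-1) ^ j * ((2 * m).choose j : ℂ))).congr
        (Eventually.of_forall fun y => ?_)
      simp only
      ring
  have h2 : op (fun ξ => avgSymbol ψ m (δ • ξ)) f x =
      ∑ j ∈ (Finset.range (2 * m + 1)).erase m,
        (-((-1) ^ m / ((2 * m).choose m : ℂ)) * ((-1) ^ j * ((2 * m).choose j : ℂ))) *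
        ∫ y, 𝓕⁻ (ψ : E n → ℂ) y * f (x - (((m : ℝ) - j) * δ) • y) := by
    unfold avgSymbol
    simp_rw [smul_smul]
    have hne : ∀ j ∈ (Finset.range (2 * m + 1)).erase m, ((m : ℝ) - j) * δ ≠ 0 :=
      fun j hj => mul_ne_zero (sub_ne_zero_of_mem_erase hj) hδ.ne'
    rw [op_sum_left fun j hj => (hg.dilate (hne j hj)).const_mul _]
    simp only [BoundedContinuousFunction.coe_sum, Finset.sum_apply]
    refine Finset.sum_congr rfl fun j hj => ?_
    rw [op_const_mul _ (hg.dilate (hne j hj)), BoundedContinuousFunction.smul_apply,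
      op_dilate_apply hg (hne j hj), smul_eq_mul]
  rw [h1, h2, ← Finset.add_sum_erase _ _ (show m ∈ Finset.range (2 * m + 1) by simp; omega)]
  simp only [sub_self, zero_mul, zero_smul, sub_zero, integral_mul_const, hone, one_mul]
  rw [mul_add, Finset.mul_sum, sub_eq_add_neg, ← Finset.sum_neg_distrib]
  congr 1
  · have : ((-1 : ℂ) ^ m) * (-1) ^ m = 1 := by rw [← mul_pow]; simp
    field_simp
    linear_combination (-(f x)) * this
  · refine Finset.sum_congr rfl fun j _ => ?_
    ring

/-- Of the 2k differences, k use the hypothesis and k cost 2^k; the Schwartz kernel has finite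
moment of order s. -/
lemma exists_norm_sub_op_avgSymbol_le {ψ : 𝓢(E n, ℂ)} (hψ : ψ 0 = 1) {s : ℝ} (hs : 0 < s)
    (k : ℕ) :
    ∃ C : ℝ, 0 ≤ C ∧ ∀ (f : E n →ᵇ ℂ) (M : ℝ), 0 ≤ M →
      (∀ h, ‖(bdiff h ^ k) f‖ ≤ M * ‖h‖ ^ s) → ∀ δ : ℝ, 0 < δ →
      ‖f - op (fun ξ => avgSymbol ψ k (δ • ξ)) f‖ ≤ C * M * δ ^ s := by
  have hI : Integrable fun y => ‖𝓕⁻ (ψ : E n → ℂ) y‖ * ‖y‖ ^ s := by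
    rw [← SchwartzMap.fourierInv_coe]
    exact integrable_norm_rpow_mul_schwartz _ hs.le
  set I := ∫ y, ‖𝓕⁻ (ψ : E n → ℂ) y‖ * ‖y‖ ^ s with hIdef
  have hI0 : 0 ≤ I := integral_nonneg fun y => by positivity
  refine ⟨2 ^ k * I, mul_nonneg (by positivity) hI0, fun f M hM hf δ hδ => ?_⟩
  have hnn : 0 ≤ 2 ^ k * I * M * δ ^ s :=
    mul_nonneg (mul_nonneg (mul_nonneg (by positivity) hI0) hM) (by positivity)
  refine (BoundedContinuousFunction.norm_le hnn).2 fun x => ?_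
  rw [BoundedContinuousFunction.sub_apply, sub_op_avgSymbol_apply hψ k hδ, norm_mul]
  have h1 : ‖((-1 : ℂ) ^ k / ((2 * k).choose k : ℂ))‖ ≤ 1 := by
    rw [norm_div, norm_pow, norm_neg, norm_one, one_pow, Complex.norm_natCast]
    have : (1 : ℝ) ≤ ((2 * k).choose k : ℝ) := by
      exact_mod_cast Nat.choose_pos (by omega)
    exact (div_le_one (by linarith)).2 this
  have h2 : ∀ y, ‖𝓕⁻ (ψ : E n → ℂ) y * (bdiff (δ • y) ^ (2 * k)) f x‖ ≤
      (2 ^ k * M * δ ^ s) * (‖𝓕⁻ (ψ : E n → ℂ) y‖ * ‖y‖ ^ s) := by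
    intro y
    rw [norm_mul]
    have h3 : ‖(bdiff (δ • y) ^ (2 * k)) f x‖ ≤ 2 ^ k * (M * (δ ^ s * ‖y‖ ^ s)) := by
      refine (BoundedContinuousFunction.norm_coe_le_norm _ x).trans ?_
      rw [two_mul, pow_add, Module.End.mul_apply]
      refine (norm_bdiff_pow_le _ _ _).trans ?_
      gcongr
      refine (hf _).trans (le_of_eq ?_)
      rw [norm_smul, Real.norm_of_nonneg hδ.le, Real.mul_rpow hδ.le (norm_nonneg _)]
    calc _ ≤ ‖𝓕⁻ (ψ : E n → ℂ) y‖ * (2 ^ k * (M * (δ ^ s * ‖y‖ ^ s))) := by gcongr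
      _ = _ := by ring
  have h4 : ‖∫ y, 𝓕⁻ (ψ : E n → ℂ) y * (bdiff (δ • y) ^ (2 * k)) f x‖ ≤
      (2 ^ k * M * δ ^ s) * I := by
    rw [hIdef, ← integral_const_mul]
    exact norm_integral_le_of_norm_le (hI.const_mul _) (Eventually.of_forall h2)
  calc _ ≤ 1 * ((2 ^ k * M * δ ^ s) * I) :=
        mul_le_mul h1 h4 (norm_nonneg _) zero_le_one
    _ = _ := by ring

/-! ### From differences to the heat semigroup -/

/-- The power |2πξ|^β = δ^{-β} |2πδξ|^β is absorbed by the average instead of the semigroup. What is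
left of the semigroup is bounded uniformly in t, hence no singularity as t → 0. -/
lemma exists_norm_op_heatSymbol_avg_le (hn : 0 < n) {α β : ℝ} (hα : 0 < α) (hβ : 0 < β)
    (ψ : 𝓢(E n, ℂ)) (m : ℕ) :
    ∃ C : ℝ, 0 ≤ C ∧ ∀ t : ℝ, 0 < t → ∀ δ : ℝ, 0 < δ → ∀ v : E n →ᵇ ℂ,
      ‖op (heatSymbol n β α t) (op (fun ξ => avgSymbol ψ m (δ • ξ)) v)‖ ≤
        C * δ ^ (-β) * ‖v‖ := by
  have hg := isGood_rpow_mul_avgSymbol hn hβ ψ m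
  set K := ∫ y, ‖𝓕⁻ (fun ξ : E n => (((2 * Real.pi * ‖ξ‖) ^ β : ℝ) : ℂ) * avgSymbol ψ m ξ) y‖
    with hK
  have hK0 : 0 ≤ K := integral_nonneg fun y => norm_nonneg _
  refine ⟨expNorm n 0 α * K, mul_nonneg (expNorm_nonneg _ _ _) hK0, fun t ht δ hδ v => ?_⟩
  have hπ := Real.pi_pos
  have hgd := hg.dilate hδ.ne'
  rw [← op_mul (isGood_heatSymbol hn hβ.le hα ht) ((isGood_avgSymbol ψ m).dilate hδ.ne')]
  have e : (fun ξ => heatSymbol n β α t ξ * avgSymbol ψ m (δ • ξ)) =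
      fun ξ => heatSymbol n 0 α t ξ * (((δ ^ (-β) : ℝ) : ℂ) *
        ((((2 * Real.pi * ‖δ • ξ‖) ^ β : ℝ) : ℂ) * avgSymbol ψ m (δ • ξ))) := by
    ext ξ
    have e1 : (2 * Real.pi * ‖ξ‖) ^ β = δ ^ (-β) * (2 * Real.pi * ‖δ • ξ‖) ^ β := by
      rw [norm_smul, mul_left_comm, Real.norm_of_nonneg hδ.le, Real.mul_rpow hδ.le (by positivity),
        ← mul_assoc, ← Real.rpow_add hδ]
      simp
    rw [heatSymbol, heatSymbol, Real.rpow_zero, e1]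
    push_cast
    ring
  rw [e, op_mul (isGood_heatSymbol hn le_rfl hα ht) (hgd.const_mul _), op_const_mul _ hgd]
  refine (norm_op_heatSymbol_le hn le_rfl hα ht _).trans ?_
  rw [zero_div, neg_zero, Real.rpow_zero, mul_one, norm_smul, Complex.norm_real,
    Real.norm_of_nonneg (by positivity)]
  have h1 := hg.norm_op_dilate_le hδ.ne' v
  have h0 := expNorm_nonneg n 0 α
  calc _ ≤ expNorm n 0 α * (δ ^ (-β) * (K * ‖v‖)) := by gcongr
    _ = _ := by ring

/-- Dyadic decomposition from scale t^{1/α} upwards. Squares of averages are telescoped because B_a²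
- B_b² = (B_a + B_b)(B_a - B_b): one factor absorbs the fractional power, the other is small on f.
-/
theorem exists_norm_op_heatSymbol_le_of_bdiff (hn : 0 < n) {α β s : ℝ} (hα : 0 < α) (hs : 0 < s)
    (hsβ : s < β) (k : ℕ) :
    ∃ C : ℝ, 0 ≤ C ∧ ∀ (f : E n →ᵇ ℂ) (M : ℝ), 0 ≤ M →
      (∀ h, ‖(bdiff h ^ k) f‖ ≤ M * ‖h‖ ^ s) → ∀ t : ℝ, 0 < t →
      ‖op (heatSymbol n β α t) f‖ ≤ C * M * t ^ ((s - β) / α) := by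
  have hβ : 0 < β := hs.trans hsβ
  obtain ⟨ψ, hψ⟩ := exists_schwartz_eq_one n
  obtain ⟨C₁, hC₁, happrox⟩ := exists_norm_sub_op_avgSymbol_le hψ hs k
  obtain ⟨C₂, hC₂, hsmooth⟩ := exists_norm_op_heatSymbol_avg_le hn hα hβ ψ k
  have hg := isGood_avgSymbol ψ k
  set K := ∫ y, ‖𝓕⁻ (avgSymbol ψ k) y‖ with hK
  have hK0 : 0 ≤ K := integral_nonneg fun y => norm_nonneg _
  set K₁ := expNorm n β α with hK₁
  have hK₁0 : 0 ≤ K₁ := expNorm_nonneg _ _ _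
  clear_value K K₁
  set K₃ := C₂ * 2 * (C₁ * (1 + 2 ^ s)) with hK₃
  have hK₃0 : 0 ≤ K₃ := by positivity
  -- The ratio of the geometric series over dyadic scales, below 1 because s < β.
  set ρ : ℝ := 2 ^ (s - β) with hρ
  have hρ0 : 0 < ρ := by positivity
  have hρ1 : ρ < 1 := Real.rpow_lt_one_of_one_lt_of_neg one_lt_two (by linarith)
  have hρ2 : 0 < 1 - ρ := by linarith
  refine ⟨K₁ * ((1 + K) * C₁) + K₃ * (1 - ρ)⁻¹, by positivity, fun f M hM hf t ht => ?_⟩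
  set B : ℝ → (E n →ᵇ ℂ) → (E n →ᵇ ℂ) := fun δ => op (fun ξ => avgSymbol ψ k (δ • ξ)) with hB
  have hBg : ∀ δ : ℝ, 0 < δ → IsGood (fun ξ : E n => avgSymbol ψ k (δ • ξ)) :=
    fun δ hδ => hg.dilate hδ.ne'
  have hBnorm : ∀ δ : ℝ, 0 < δ → ∀ v, ‖B δ v‖ ≤ K * ‖v‖ := fun δ hδ v => by
    rw [hK]; exact hg.norm_op_dilate_le hδ.ne' v
  have hBcomm : ∀ a b : ℝ, 0 < a → 0 < b → ∀ v, B a (B b v) = B b (B a v) := by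
    intro a b ha hb v
    simp only [hB]
    rw [← op_mul (hBg a ha) (hBg b hb), ← op_mul (hBg b hb) (hBg a ha)]
    simp only [mul_comm]
  have hGg := isGood_heatSymbol (n := n) hn hβ.le hα ht
  set G : (E n →ᵇ ℂ) → (E n →ᵇ ℂ) := op (heatSymbol n β α t) with hG
  have happ : ∀ δ : ℝ, 0 < δ → ‖f - B δ f‖ ≤ C₁ * M * δ ^ s := happrox f M hM hf
  have hstep : ∀ a : ℝ, 0 < a →
      ‖G (B a (B a f))‖ ≤ K₃ * M * a ^ (s - β) + ‖G (B (2 * a) (B (2 * a) f))‖ := by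
    intro a ha
    have ha2 : 0 < 2 * a := by positivity
    set v := B a f - B (2 * a) f with hv
    have hvn : ‖v‖ ≤ C₁ * (1 + 2 ^ s) * M * a ^ s := by
      have e : v = (f - B (2 * a) f) - (f - B a f) := by rw [hv]; abel
      rw [e]
      refine (norm_sub_le _ _).trans ?_
      have h1 := happ a ha
      have h2 := happ (2 * a) ha2
      rw [Real.mul_rpow zero_le_two ha.le] at h2
      linarith
    have e2 : G (B a (B a f)) = G (B a v) + G (B (2 * a) v) + G (B (2 * a) (B (2 * a) f)) := by
      have e3 : B a v = B a (B a f) - B a (B (2 * a) f) := (hBg a ha).op_sub _ _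
      have e4 : B (2 * a) v = B (2 * a) (B a f) - B (2 * a) (B (2 * a) f) :=
        (hBg _ ha2).op_sub _ _
      rw [← hGg.op_add, ← hGg.op_add, e3, e4, hBcomm (2 * a) a ha2 ha]
      congr 1
      abel
    rw [e2]
    refine (norm_add_le _ _).trans (add_le_add ?_ le_rfl)
    refine (norm_add_le _ _).trans ?_
    have h1 := hsmooth t ht a ha v
    have h2 := hsmooth t ht (2 * a) ha2 v
    have h3 : (2 * a) ^ (-β) ≤ a ^ (-β) :=
      Real.rpow_le_rpow_of_nonpos ha (by linarith) (by linarith)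
    have h4 : a ^ (-β) * a ^ s = a ^ (s - β) := by
      rw [← Real.rpow_add ha]
      congr 1
      ring
    calc _ ≤ C₂ * a ^ (-β) * ‖v‖ + C₂ * a ^ (-β) * ‖v‖ := by
          refine add_le_add h1 (h2.trans ?_)
          gcongr
      _ = C₂ * 2 * a ^ (-β) * ‖v‖ := by ring
      _ ≤ C₂ * 2 * a ^ (-β) * (C₁ * (1 + 2 ^ s) * M * a ^ s) := by gcongr
      _ = K₃ * M * (a ^ (-β) * a ^ s) := by rw [hK₃]; ring
      _ = _ := by rw [h4]
  -- At this scale the bound t^{-β/α} δ^s for f - B_δ² f has the same size as δ^{s-β}.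
  set δ := t ^ α⁻¹ with hδ
  have hδ0 : 0 < δ := by positivity
  have hδs : δ ^ (s - β) = t ^ ((s - β) / α) := by
    rw [hδ, ← Real.rpow_mul ht.le]
    congr 1
    ring
  have hsum : ∀ J : ℕ, ‖G (B δ (B δ f))‖ ≤
      K₃ * M * δ ^ (s - β) * ∑ j ∈ Finset.range J, ρ ^ j +
        ‖G (B (2 ^ J * δ) (B (2 ^ J * δ) f))‖ := by
    intro J
    induction J with
    | zero => simp
    | succ J ih =>
      have h1 := hstep (2 ^ J * δ) (by positivity)
      have e : (2 ^ J * δ) ^ (s - β) = ρ ^ J * δ ^ (s - β) := by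
        rw [Real.mul_rpow (by positivity) hδ0.le, hρ, ← Real.rpow_natCast (2 ^ (s - β)) J,
          ← Real.rpow_mul zero_le_two, ← Real.rpow_natCast 2 J, ← Real.rpow_mul zero_le_two,
          mul_comm (J : ℝ)]
      rw [e, ← mul_assoc 2, ← pow_succ'] at h1
      rw [Finset.sum_range_succ]
      linarith
  have hgeom : ∀ J : ℕ, ∑ j ∈ Finset.range J, ρ ^ j ≤ (1 - ρ)⁻¹ := by
    intro J
    rw [← tsum_geometric_of_lt_one hρ0.le hρ1]
    exact (summable_geometric_of_lt_one hρ0.le hρ1).sum_le_tsum _ fun j _ => by positivity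
  -- The term at the coarsest scale disappears since f is bounded and β > 0.
  have hlim : Tendsto (fun J : ℕ => C₂ * (2 ^ J * δ) ^ (-β) * (K * ‖f‖)) atTop (𝓝 0) := by
    have h1 : Tendsto (fun J : ℕ => (2 : ℝ) ^ J * δ) atTop atTop :=
      (tendsto_pow_atTop_atTop_of_one_lt one_lt_two).atTop_mul_const hδ0
    have h2 := (((tendsto_rpow_neg_atTop hβ).comp h1).const_mul C₂).mul_const (K * ‖f‖)
    simpa using h2
  have hmain : ‖G (B δ (B δ f))‖ ≤ K₃ * M * δ ^ (s - β) * (1 - ρ)⁻¹ := by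
    have h1 := hlim.const_add (K₃ * M * δ ^ (s - β) * (1 - ρ)⁻¹)
    rw [add_zero] at h1
    refine ge_of_tendsto' h1 fun J => (hsum J).trans (add_le_add ?_ ?_)
    · exact mul_le_mul_of_nonneg_left (hgeom J) (by positivity)
    · have hp : 0 < 2 ^ J * δ := by positivity
      refine (hsmooth t ht _ hp _).trans ?_
      exact mul_le_mul_of_nonneg_left (hBnorm _ hp _) (by positivity)
  have hfirst : ‖G (f - B δ (B δ f))‖ ≤ K₁ * ((1 + K) * C₁) * M * δ ^ (s - β) := by
    have h1 : ‖f - B δ (B δ f)‖ ≤ (1 + K) * (C₁ * M * δ ^ s) := by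
      have e : f - B δ (B δ f) = (f - B δ f) + B δ (f - B δ f) := by
        have : B δ (f - B δ f) = B δ f - B δ (B δ f) := (hBg δ hδ0).op_sub _ _
        rw [this]
        abel
      rw [e]
      refine (norm_add_le _ _).trans ?_
      have h2 := hBnorm δ hδ0 (f - B δ f)
      have h3 := happ δ hδ0
      calc _ ≤ ‖f - B δ f‖ + K * ‖f - B δ f‖ := by gcongr
        _ = (1 + K) * ‖f - B δ f‖ := by ring
        _ ≤ _ := by gcongr
    have h2 : t ^ (-(β / α)) * δ ^ s = δ ^ (s - β) := by
      rw [hδs, hδ, ← Real.rpow_mul ht.le, ← Real.rpow_add ht]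
      congr 1
      ring
    have h3 := norm_op_heatSymbol_le hn hβ.le hα ht (f - B δ (B δ f))
    rw [← hK₁] at h3
    calc _ ≤ K₁ * t ^ (-(β / α)) * ‖f - B δ (B δ f)‖ := h3
      _ ≤ K₁ * t ^ (-(β / α)) * ((1 + K) * (C₁ * M * δ ^ s)) := by gcongr
      _ = K₁ * ((1 + K) * C₁) * M * (t ^ (-(β / α)) * δ ^ s) := by ring
      _ = _ := by rw [h2]
  have hdec : G f = G (f - B δ (B δ f)) + G (B δ (B δ f)) := by
    rw [← hGg.op_add, sub_add_cancel]
  rw [hdec, ← hδs]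
  refine (norm_add_le _ _).trans ?_
  linarith

/-! ### The norm inequalities -/

lemma eLpNorm_eq_norm_toBCF (f : E n → ℝ) (hf : Continuous f) {M : ℝ} (hM : ∀ x, |f x| ≤ M) :
    eLpNorm f ∞ volume = ENNReal.ofReal ‖toBCF f hf hM‖ := by
  rw [← eLpNorm_bcf]
  refine eLpNorm_congr_norm_ae (Eventually.of_forall fun x => ?_)
  rw [toBCF_apply, Complex.norm_real]

lemma abs_iterDiff_eq (k : ℕ) (f : E n → ℝ) (hf : Continuous f) {M : ℝ} (hM : ∀ x, |f x| ≤ M)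
    (h x : E n) : |iterDiff k h f x| = ‖(bdiff h ^ k) (toBCF f hf hM) x‖ := by
  rw [bdiff_pow_apply h k _ f fun x => toBCF_apply f hf hM x, Complex.norm_real,
    Real.norm_eq_abs]

lemma iterDiff_le_lipNorm {s : ℝ} (f : E n → ℝ) (h x : E n) (h0 : 0 < ‖h‖) (h1 : ‖h‖ ≤ 1) :
    ENNReal.ofReal |iterDiff (⌊s⌋₊ + 1) h f x| ≤ lipNorm s f * ENNReal.ofReal (‖h‖ ^ s) := by
  have hpos : 0 < ENNReal.ofReal (‖h‖ ^ s) := ENNReal.ofReal_pos.2 (by positivity)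
  rw [← ENNReal.div_le_iff hpos.ne' ENNReal.ofReal_ne_top]
  have e1 : ENNReal.ofReal |iterDiff (⌊s⌋₊ + 1) h f x| ≤ modulus (⌊s⌋₊ + 1) f x ‖h‖ :=
    le_iSup₂_of_le (f := fun (h' : E n) (_ : ‖h'‖ = ‖h‖) =>
      ENNReal.ofReal |iterDiff (⌊s⌋₊ + 1) h' f x|) h rfl le_rfl
  refine (ENNReal.div_le_div_right e1 _).trans ?_
  refine le_trans ?_ le_add_self
  exact le_iSup_of_le ‖h‖ (le_iSup₂_of_le ⟨h0, h1⟩ x le_rfl)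

lemma lipNorm_le {s A : ℝ} (f : E n → ℝ)
    (hA : ∀ h x : E n, |iterDiff (⌊s⌋₊ + 1) h f x| ≤ A * ‖h‖ ^ s) :
    lipNorm s f ≤ eLpNorm f ∞ volume + ENNReal.ofReal A := by
  refine add_le_add le_rfl (iSup_le fun y => iSup₂_le fun hy x => ?_)
  refine ENNReal.div_le_of_le_mul (iSup₂_le fun h hh => ?_)
  have hy0 := hy.1
  rw [← ENNReal.ofReal_mul' (by positivity)]
  refine ENNReal.ofReal_le_ofReal ?_
  rw [← hh]
  exact hA h x

theorem exists_heatSup_le (hn : 0 < n) {s α : ℝ} (hs : 0 < s) (hα : 0 < α) {r : ℕ}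
    (hrs : s < α * r) :
    ∃ C : ℝ≥0, ∀ f : E n → ℝ, Continuous f → MemLp f ∞ volume →
      heatSup α s r f ≤ C * lipNorm s f := by
  set k := ⌊s⌋₊ + 1 with hk
  obtain ⟨C, hC, hC'⟩ := exists_norm_op_heatSymbol_le_of_bdiff hn hα hs hrs k
  -- The summand 1 keeps the constant nonzero, so that its product with an infinite norm is
  -- infinite.
  refine ⟨Real.toNNReal (C * 2 ^ k) + 1, fun f hf hfm => ?_⟩
  rcases eq_or_ne (lipNorm s f) ∞ with htop | htop
  · rw [htop, ENNReal.mul_top (by positivity)]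
    exact le_top
  have hM := fun x => norm_le_of_memLp_top hf hfm x
  simp only [Real.norm_eq_abs] at hM
  set F := toBCF f hf hM with hF
  set L := (lipNorm s f).toReal with hL
  have hL0 : 0 ≤ L := ENNReal.toReal_nonneg
  have hFL : ‖F‖ ≤ L := by
    have h1 : ENNReal.ofReal ‖F‖ ≤ lipNorm s f := by
      rw [hF, ← eLpNorm_eq_norm_toBCF]
      exact le_self_add
    exact (ENNReal.ofReal_le_iff_le_toReal htop).1 h1
  -- The norm sees only steps |h| ≤ 1; for |h| ≥ 1 the bound 2^k ‖f‖ suffices. The factor 2^k covers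
  -- both ranges.
  have hdiff : ∀ h : E n, ‖(bdiff h ^ k) F‖ ≤ 2 ^ k * L * ‖h‖ ^ s := by
    intro h
    rcases eq_or_ne h 0 with rfl | hh
    · rw [bdiff_zero, zero_pow (by omega), norm_zero, Real.zero_rpow hs.ne']
      simp
    have hh0 : 0 < ‖h‖ := norm_pos_iff.2 hh
    rcases le_total ‖h‖ 1 with h1 | h1
    · refine (BoundedContinuousFunction.norm_le (by positivity)).2 fun x => ?_
      rw [← abs_iterDiff_eq]
      have h2 := iterDiff_le_lipNorm (s := s) f h x hh0 h1
      rw [← ENNReal.ofReal_toReal htop, ← hL, ← ENNReal.ofReal_mul hL0] at h2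
      have h3 := (ENNReal.ofReal_le_ofReal_iff (by positivity)).1 h2
      refine h3.trans ?_
      rw [mul_assoc]
      exact le_mul_of_one_le_left (by positivity) (one_le_pow₀ one_le_two)
    · calc _ ≤ 2 ^ k * ‖F‖ := norm_bdiff_pow_le _ _ _
        _ ≤ 2 ^ k * L * 1 := by rw [mul_one]; gcongr
        _ ≤ _ := by
          gcongr
          exact Real.one_le_rpow h1 hs.le
  have hβ : 0 < α * r := hs.trans hrs
  refine iSup₂_le fun t ht => ?_
  rw [fracLaplacianNorm_heat hn hβ hα ht f hf hM, ← ENNReal.ofReal_mul (by positivity)]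
  have h1 := hC' F (2 ^ k * L) (by positivity) hdiff t ht
  have h2 : t ^ ((r : ℝ) - s / α) * t ^ ((s - α * r) / α) = 1 := by
    rw [← Real.rpow_add ht, sub_div, mul_div_cancel_left₀ _ hα.ne']
    simp
  have h3 : t ^ ((r : ℝ) - s / α) * ‖op (heatSymbol n (α * r) α t) F‖ ≤ (C * 2 ^ k) * L := by
    calc _ ≤ t ^ ((r : ℝ) - s / α) * (C * (2 ^ k * L) * t ^ ((s - α * r) / α)) := by gcongr
      _ = (C * 2 ^ k) * L * (t ^ ((r : ℝ) - s / α) * t ^ ((s - α * r) / α)) := by ring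
      _ = _ := by rw [h2, mul_one]
  refine (ENNReal.ofReal_le_ofReal h3).trans ?_
  rw [ENNReal.ofReal_mul (by positivity), hL, ENNReal.ofReal_toReal htop]
  gcongr
  push_cast
  exact le_self_add

theorem exists_lipNorm_le (hn : 0 < n) {s α : ℝ} (hs : 0 < s) (hα : 0 < α) {r : ℕ} (hr : 0 < r) :
    ∃ C : ℝ≥0, ∀ f : E n → ℝ, Continuous f → MemLp f ∞ volume →
      lipNorm s f ≤ eLpNorm f ∞ volume + C * heatSup α s r f := by
  obtain ⟨r, rfl⟩ := Nat.exists_eq_succ_of_ne_zero hr.ne'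
  have hk : s < (⌊s⌋₊ + 1 : ℕ) := by exact_mod_cast Nat.lt_floor_add_one s
  obtain ⟨C, hC, hC'⟩ := exists_norm_bdiff_pow_le_of_heat hn hα hs r hk
  refine ⟨Real.toNNReal C + 1, fun f hf hfm => ?_⟩
  rcases eq_or_ne (heatSup α s (r + 1) f) ∞ with htop | htop
  · rw [htop, ENNReal.mul_top (by positivity), add_top]
    exact le_top
  have hM := fun x => norm_le_of_memLp_top hf hfm x
  simp only [Real.norm_eq_abs] at hM
  set F := toBCF f hf hM with hF
  set S := (heatSup α s (r + 1) f).toReal with hS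
  have hS0 : 0 ≤ S := ENNReal.toReal_nonneg
  have hβ : 0 < α * (r + 1 : ℕ) := by positivity
  have hheat : ∀ t : ℝ, 0 < t → ‖op (heatSymbol n (α * (r + 1 : ℕ)) α t) F‖ ≤
      S * t ^ (s / α - (r + 1 : ℕ)) := by
    intro t ht
    have h1 : ENNReal.ofReal (t ^ (((r + 1 : ℕ) : ℝ) - s / α)) *
        fracLaplacianNorm (α * (r + 1 : ℕ)) (heat α t f) ≤ heatSup α s (r + 1) f :=
      le_iSup₂_of_le (f := fun (t : ℝ) (_ : 0 < t) =>
        ENNReal.ofReal (t ^ (((r + 1 : ℕ) : ℝ) - s / α)) *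
          fracLaplacianNorm (α * (r + 1 : ℕ)) (heat α t f)) t ht le_rfl
    rw [fracLaplacianNorm_heat hn hβ hα ht f hf hM, ← ENNReal.ofReal_mul (by positivity),
      ENNReal.ofReal_le_iff_le_toReal htop, ← hS, ← hF] at h1
    rw [← neg_sub, Real.rpow_neg ht.le, ← div_eq_mul_inv, le_div_iff₀ (by positivity), mul_comm]
    exact h1
  have hdiff := hC' F S hS0 hheat
  refine (lipNorm_le f (A := C * S) fun h x => ?_).trans (add_le_add le_rfl ?_)
  · rw [abs_iterDiff_eq _ f hf hM]
    exact hdiff h x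
  · rw [ENNReal.ofReal_mul hC, hS, ENNReal.ofReal_toReal htop]
    gcongr
    push_cast
    exact le_self_add

end FracHeat

end

/-! ### Equivalence of the norms -/

theorem theorem5p7 (n : ℕ) (hn : 0 < n) (s α : ℝ) (hs : 0 < s) (hα : 0 < α)
    (r : ℕ) (hr : 0 < r) (hrs : s < α * r) :
    ∃ c C : ℝ≥0, 0 < c ∧ 0 < C ∧
      ∀ f : FracHeat.E n → ℝ, Continuous f → MemLp f ∞ volume →
        (f ∈ FracHeat.LipSpace n s ↔ FracHeat.heatSup α s r f < ∞) ∧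
        (f ∈ FracHeat.LipSpace n s →
          c * (eLpNorm f ∞ volume + FracHeat.heatSup α s r f) ≤ FracHeat.lipNorm s f ∧
          FracHeat.lipNorm s f ≤ C * (eLpNorm f ∞ volume + FracHeat.heatSup α s r f)) := by
  obtain ⟨C₁, h₁⟩ := FracHeat.exists_heatSup_le hn hs hα hrs
  obtain ⟨C₂, h₂⟩ := FracHeat.exists_lipNorm_le hn hs hα hr
  refine ⟨(1 + C₁)⁻¹, 1 + C₂, by positivity, by positivity, fun f hf hfm => ⟨⟨fun h => ?_,
    fun h => ⟨hf, ?_⟩⟩, fun _ => ⟨?_, ?_⟩⟩⟩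
  · exact (h₁ f hf hfm).trans_lt (ENNReal.mul_lt_top ENNReal.coe_lt_top h.2)
  · exact (h₂ f hf hfm).trans_lt
      (ENNReal.add_lt_top.2 ⟨hfm.2, ENNReal.mul_lt_top ENNReal.coe_lt_top h⟩)
  · have h3 : eLpNorm f ∞ volume + FracHeat.heatSup α s r f ≤
        ((1 + C₁ : ℝ≥0) : ℝ≥0∞) * FracHeat.lipNorm s f := by
      rw [ENNReal.coe_add, ENNReal.coe_one, add_mul, one_mul]
      exact add_le_add le_self_add (h₁ f hf hfm)
    calc _ ≤ (((1 + C₁)⁻¹ : ℝ≥0) : ℝ≥0∞) *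
          (((1 + C₁ : ℝ≥0) : ℝ≥0∞) * FracHeat.lipNorm s f) := by gcongr
      _ = FracHeat.lipNorm s f := by
        rw [← mul_assoc, ← ENNReal.coe_mul, inv_mul_cancel₀ (by positivity), ENNReal.coe_one,
          one_mul]
  · refine (h₂ f hf hfm).trans ?_
    rw [ENNReal.coe_add, ENNReal.coe_one, mul_add]
    refine add_le_add ?_ ?_
    · exact le_mul_of_one_le_left zero_le le_self_add
    · gcongr
      exact le_add_self
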